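/- Let $R$ be a countable (finite or countably infinite) ring with $1\neq 0$, not necessarily commutative. Let $S_R$ be the first-order theory of unital left $R$-modules with four distinguished submodules: its language is $\{+,0\}\cup\{r\cdot\,: r\in R\}\cup\{U_0,U_1,U_2,U_3\}$, with each $U_i$ a unary predicate, and its models are the unital left $R$-modules in which each $U_i$ is interpreted as a submodule. Then $S_R$ is Borel complete. Here, for a countable language $\mathcal L$, the set $\mathrm{Str}_{\mathcal L}$ of $\mathcal L$-structures with universe $\omega$ carries its usual Polish topology, and for a countable set $T$ of $\mathcal L_{\omega_1\omega}$-sentences (in particular, for a countable first-order theory) $\mathrm{Mod}(T)\subseteq \mathrm{Str}_{\mathcal L}$ is the set of models of $T$ with universe $\omega$. For such theories $T$ and $S$, in countable languages $\mathcal L$ and $\mathcal L'$ respectively, write $T\le_B S$ if there is a Borel function $f:\mathrm{Mod}(T)\to \mathrm{Mod}(S)$ such that for all $M,N\in\mathrm{Mod}(T)$, $f(M)\cong_{\mathcal L'} f(N)$ if and only if $M\cong_{\mathcal L} N$. The theory $S$ is Borel complete if $T\le_B S$ for every countable language $\mathcal L$ and every countable $\mathcal L_{\omega_1\omega}$-theory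 $T$. -/

import Mathlib

namespace BorelModels

universe u v u' v'

/-! ### The infinitary logic with countable conjunctions and finite quantifier strings -/

/-- Formulas of `L_{ω₁ω}` with free variables among `x_0, …, x_{n-1}`: atomic formulas are closed
under implication, universal quantification and countable conjunction. -/
inductive InfFormula (L : FirstOrder.Language.{u, v}) : ℕ → Type (max u v)
  | falsum {n : ℕ} : InfFormula L n
  | equal {n : ℕ} (t₁ t₂ : L.Term (Empty ⊕ Fin n)) : InfFormula L n
  | rel {n l : ℕ} (r : L.Relations l) (ts : Fin l → L.Term (Empty ⊕ Fin n)) : InfFormula L n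
  | imp {n : ℕ} (φ ψ : InfFormula L n) : InfFormula L n
  | all {n : ℕ} (φ : InfFormula L (n + 1)) : InfFormula L n
  | conj {n : ℕ} (φ : ℕ → InfFormula L n) : InfFormula L n

/-- Satisfaction of an `L_{ω₁ω}` formula in a structure, under an assignment of its free
variables. -/
def InfFormula.Realize {L : FirstOrder.Language.{u, v}} {M : Type*} [L.Structure M] :
    {n : ℕ} → InfFormula L n → (Fin n → M) → Prop
  | _, .falsum, _ => False
  | _, .equal t₁ t₂, x =>
      t₁.realize (Sum.elim Empty.elim x) = t₂.realize (Sum.elim Empty.elim x)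
  | _, .rel r ts, x =>
      FirstOrder.Language.Structure.RelMap r (fun i => (ts i).realize (Sum.elim Empty.elim x))
  | _, .imp φ ψ, x => φ.Realize x → ψ.Realize x
  | _, .all φ, x => ∀ a : M, φ.Realize (Fin.snoc x a)
  | _, .conj φ, x => ∀ k : ℕ, (φ k).Realize x

/-- A finitary first-order formula, seen as a formula of `L_{ω₁ω}`. -/
def InfFormula.ofFirstOrder {L : FirstOrder.Language.{u, v}} :
    {n : ℕ} → L.BoundedFormula Empty n → InfFormula L n
  | _, .falsum => .falsum
  | _, .equal t₁ t₂ => .equal t₁ t₂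
  | _, .rel r ts => .rel r ts
  | _, .imp φ ψ => .imp (ofFirstOrder φ) (ofFirstOrder ψ)
  | _, .all φ => .all (ofFirstOrder φ)

/-- The sentences of `L_{ω₁ω}`. -/
abbrev InfSentence (L : FirstOrder.Language.{u, v}) : Type (max u v) := InfFormula L 0

/-- An `L_{ω₁ω}` theory. -/
abbrev InfTheory (L : FirstOrder.Language.{u, v}) : Type (max u v) := Set (InfSentence L)

/-! ### The space of structures with universe `ℕ` -/

/-- The space of all `L`-structures with universe `ℕ`. -/
structure Str (L : FirstOrder.Language.{u, v}) : Type (max u v) where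
  /-- The interpretation of the symbols of `L`. -/
  str : L.Structure ℕ

namespace Str

variable {L : FirstOrder.Language.{u, v}}

/-- The value of the function symbol `f` in the structure `M`. -/
def evalFun (M : Str L) {n : ℕ} (f : L.Functions n) (a : Fin n → ℕ) : ℕ :=
  M.str.funMap f a

/-- The truth value of the relation symbol `r` in the structure `M`. -/
def evalRel (M : Str L) {n : ℕ} (r : L.Relations n) (a : Fin n → ℕ) : Prop :=
  M.str.RelMap r a

/-- The structure `M` satisfies the `L_{ω₁ω}` sentence `φ`. -/
def Satisfies (M : Str L) (φ : InfSentence L) : Prop :=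
  @InfFormula.Realize L ℕ M.str 0 φ Fin.elim0

/-- Isomorphism of `L`-structures with universe `ℕ`. -/
def Iso (M N : Str L) : Prop :=
  Nonempty (@FirstOrder.Language.Equiv L ℕ ℕ M.str N.str)

/-- The product topology on the space of structures: its subbasic open sets are given by the
truth or falsity of one atomic relation, or by one value of one function symbol. -/
instance : TopologicalSpace (Str L) :=
  TopologicalSpace.generateFrom
    ({s | ∃ (n : ℕ) (f : L.Functions n) (a : Fin n → ℕ) (b : ℕ), s = {M | M.evalFun f a = b}} ∪
     {s | ∃ (n : ℕ) (r : L.Relations n) (a : Fin n → ℕ), s = {M | M.evalRel r a}} ∪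
     {s | ∃ (n : ℕ) (r : L.Relations n) (a : Fin n → ℕ), s = {M | ¬ M.evalRel r a}})

/-- The Borel sets of the space of structures. -/
instance : MeasurableSpace (Str L) := borel (Str L)

instance : BorelSpace (Str L) := ⟨rfl⟩

end Str

/-- `Mod T` is the set of models of `T` with universe `ℕ`. -/
def Mod {L : FirstOrder.Language.{u, v}} (T : InfTheory L) : Set (Str L) :=
  {M | ∀ φ ∈ T, M.Satisfies φ}

/-! ### Borel reducibility and Borel completeness -/

/-- `T ≤_B S`: there is a Borel map from `Mod T` to `Mod S` that preserves and reflects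
isomorphism. -/
def BorelReducible {L : FirstOrder.Language.{u, v}} {L' : FirstOrder.Language.{u', v'}}
    (T : InfTheory L) (S : InfTheory L') : Prop :=
  ∃ F : Mod T → Mod S, Measurable F ∧
    ∀ M N : Mod T, Str.Iso (F M : Str L') (F N : Str L') ↔ Str.Iso (M : Str L) (N : Str L)

/-- `S` is Borel complete: every countable `L_{ω₁ω}` theory in a countable language is Borel
reducible to `S`. -/
def BorelComplete {L' : FirstOrder.Language.{u', v'}} (S : InfTheory L') : Prop :=
  ∀ (L : FirstOrder.Language.{0, 0}) [Countable L.Symbols] (T : InfTheory L), T.Countable →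
    BorelReducible T S

/-! ### Left `R`-modules with four distinguished submodules -/

/-- Function symbols of the language of left `R`-modules: `+`, `0`, and scalar multiplication by
each `r : R`. -/
inductive ModFunctions (R : Type u) : ℕ → Type u
  | plus : ModFunctions R 2
  | zero : ModFunctions R 0
  | scal (r : R) : ModFunctions R 1

/-- Relation symbols: four unary predicates. -/
inductive SubmodRelations : ℕ → Type
  | mem (i : Fin 4) : SubmodRelations 1

/-- The language of left `R`-modules with four additional unary predicates. -/
def langFour (R : Type u) : FirstOrder.Language.{u, 0} :=
  ⟨ModFunctions R, SubmodRelations⟩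

section Axioms

variable {R : Type u} {n : ℕ}

/-- The term `s + t`. -/
def tPlus (s t : (langFour R).Term (Empty ⊕ Fin n)) : (langFour R).Term (Empty ⊕ Fin n) :=
  FirstOrder.Language.Term.func (L := langFour R) ModFunctions.plus ![s, t]

/-- The term `0`. -/
def tZero : (langFour R).Term (Empty ⊕ Fin n) :=
  FirstOrder.Language.Term.func (L := langFour R) ModFunctions.zero ![]

/-- The term `r • t`. -/
def tScal (r : R) (t : (langFour R).Term (Empty ⊕ Fin n)) : (langFour R).Term (Empty ⊕ Fin n) :=
  FirstOrder.Language.Term.func (L := langFour R) (ModFunctions.scal r) ![t]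

/-- The variable `x_i`. -/
def tVar (i : Fin n) : (langFour R).Term (Empty ⊕ Fin n) :=
  FirstOrder.Language.Term.var (Sum.inr i)

/-- The atomic formula `t ∈ U_i`. -/
def fMem (i : Fin 4) (t : (langFour R).Term (Empty ⊕ Fin n)) :
    (langFour R).BoundedFormula Empty n :=
  FirstOrder.Language.BoundedFormula.rel (L := langFour R) (SubmodRelations.mem i) ![t]

end Axioms

/-- The first-order axioms of unital left `R`-modules; `alls` is universal closure. -/
inductive IsModuleAxiom (R : Type u) [Ring R] : (langFour R).Sentence → Prop
  | plus_assoc : IsModuleAxiom R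
      (FirstOrder.Language.Term.bdEqual (tPlus (tPlus (tVar 0) (tVar 1)) (tVar 2))
        (tPlus (tVar (n := 3) 0) (tPlus (tVar 1) (tVar 2)))).alls
  | plus_comm : IsModuleAxiom R
      (FirstOrder.Language.Term.bdEqual (tPlus (tVar 0) (tVar 1)) (tPlus (tVar (n := 2) 1) (tVar 0))).alls
  | plus_zero : IsModuleAxiom R
      (FirstOrder.Language.Term.bdEqual (tPlus (tVar 0) tZero) (tVar (n := 1) 0)).alls
  | exists_neg : IsModuleAxiom R
      (FirstOrder.Language.Term.bdEqual (tPlus (tVar 0) (tVar 1)) (tZero (n := 2))).ex.alls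
  | scal_plus (r : R) : IsModuleAxiom R
      (FirstOrder.Language.Term.bdEqual (tScal r (tPlus (tVar 0) (tVar 1)))
        (tPlus (tScal r (tVar (n := 2) 0)) (tScal r (tVar 1)))).alls
  | plus_scal (r s : R) : IsModuleAxiom R
      (FirstOrder.Language.Term.bdEqual (tScal (r + s) (tVar 0))
        (tPlus (tScal r (tVar (n := 1) 0)) (tScal s (tVar 0)))).alls
  | mul_scal (r s : R) : IsModuleAxiom R
      (FirstOrder.Language.Term.bdEqual (tScal (r * s) (tVar 0))
        (tScal r (tScal s (tVar (n := 1) 0)))).alls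
  | one_scal : IsModuleAxiom R
      (FirstOrder.Language.Term.bdEqual (tScal 1 (tVar 0)) (tVar (n := 1) 0)).alls

/-- The first-order axioms saying that each of `U_0, U_1, U_2, U_3` is a submodule. -/
inductive IsSubmoduleAxiom (R : Type u) : (langFour R).Sentence → Prop
  | zero_mem (i : Fin 4) : IsSubmoduleAxiom R (fMem (n := 0) i tZero)
  | plus_mem (i : Fin 4) : IsSubmoduleAxiom R
      ((fMem i (tVar 0)).imp
        ((fMem i (tVar 1)).imp (fMem i (tPlus (tVar (n := 2) 0) (tVar 1))))).alls
  | scal_mem (i : Fin 4) (r : R) : IsSubmoduleAxiom R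
      ((fMem i (tVar 0)).imp (fMem i (tScal r (tVar (n := 1) 0)))).alls

/-- The first-order theory of left `R`-modules with four distinguished submodules. -/
def fourSubmodulesTheory (R : Type u) [Ring R] : (langFour R).Theory :=
  {φ | IsModuleAxiom R φ ∨ IsSubmoduleAxiom R φ}

end BorelModels

/-! A structure on `ℕ` is recorded by a set `S` of labelled words, namely the graphs of its symbols,
so isomorphism becomes equivalence of such sets under `Equiv.Perm ℕ`. To each `S` one attaches four
submodules of a single fixed countable module, in a Borel way, so that isomorphism of the quadruples
is this equivalence.

The core is a countable free module with countably many endomorphisms whose commuting automorphisms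
amount to permutations of `ℕ`. An arbitrary permutation enters as a limit of elements of a countable
group, the free group acting on `ℕ` through transpositions. For each `n` the module contains a copy
of the group ring, on which a commuting automorphism is multiplication by a unit with central
coefficients. Modulo a maximal ideal of the center this is a unit of a group algebra over a field;
free groups have unique products, so it is concentrated at one element `g n`
(`MonoidAlgebra.exists_unique_coeff`). The vector `cst o` projects to `pt n o` for every `n`, and
its image has finite support, so `g n` applied to `o` is eventually constant (`exists_limit`). The
limits form the permutation wanted (`exists_perm_of_equiv`). Conversely, finite correction terms
turn a limit permutation into an automorphism (`exists_equiv_of_perm`).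

Graphs turn `S` and the endomorphisms into a countable family of submodules `U i` of a module `V`.
The family is coded by the single submodule `∑ U i [X, 1 / p i]` of the power series over `V`, for
pairwise coprime `p i`: `V` returns as the quotient by `X`, and `U i` as the constant terms of the
elements divisible by all powers of `p i` (`mem_of_divisible`, `exists_equiv_of_coded`). Finally a
submodule `N` with the endomorphism `X` is coded by `N × 0`, `0 × N`, the diagonal and the graph of
`X`. -/

open Function

/-! ### Unique products in free groups -/

/-- A function on a free group that is additive on a nontrivial subgroup, but not zero there. -/
theorem FreeGroup.exists_additive_on_subgroup {α : Type*} (H : Subgroup (FreeGroup α))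
    (hH : H ≠ ⊥) :
    ∃ F : FreeGroup α → ℤ, (∀ x ∈ H, ∀ y ∈ H, F (x * y) = F x + F y) ∧ ∃ x ∈ H, F x ≠ 0 := by
  classical
  -- Nielsen–Schreier: `H` is free, and sending each basis element to `1` gives a homomorphism to
  -- `ℤ`, nonzero once the basis is nonempty.
  obtain ⟨ι, ⟨b⟩⟩ := IsFreeGroup.nonempty_basis (G := H)
  let f : H →* Multiplicative ℤ := b.lift (fun _ => Multiplicative.ofAdd (1 : ℤ))
  refine ⟨fun x => if h : x ∈ H then Multiplicative.toAdd (f ⟨x, h⟩) else 0, ?_, ?_⟩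
  · intro x hx y hy
    have hxy : x * y ∈ H := H.mul_mem hx hy
    have : (⟨x * y, hxy⟩ : H) = ⟨x, hx⟩ * ⟨y, hy⟩ := rfl
    simp only [hx, hy, hxy, dif_pos]
    rw [this, _root_.map_mul, toAdd_mul]
  · have hne : Nonempty ι := by
      by_contra hcon
      rw [not_nonempty_iff] at hcon
      have hid : MonoidHom.id H = 1 := b.ext_hom _ _ (fun i => (hcon.false i).elim)
      apply hH
      rw [Subgroup.eq_bot_iff_forall]
      intro x hx
      have := DFunLike.congr_fun hid ⟨x, hx⟩
      simpa using congrArg Subtype.val this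
    obtain ⟨i⟩ := hne
    refine ⟨b i, (b i).2, ?_⟩
    have : f (b i) = Multiplicative.ofAdd (1 : ℤ) := congrFun (b.lift.symm_apply_apply _) i
    simp [this]

/-- Translate both sets to contain `1` and let `H` be the subgroup they generate. If `H` is trivial,
both are singletons. Otherwise take `F` additive and nonzero on `H`, and keep only the elements
where `F` is maximal: a product of two maximal elements factors only through maximal elements.
Something is discarded, since otherwise `F` would vanish on generators of `H`, so induction applies.
-/
theorem FreeGroup.exists_uniqueMul {α : Type*} :
    ∀ (n : ℕ) (A B : Finset (FreeGroup α)), A.card + B.card ≤ n → A.Nonempty → B.Nonempty →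
      ∃ a ∈ A, ∃ b ∈ B, UniqueMul A B a b := by
  classical
  intro n
  induction n with
  | zero =>
    intro A B h hA
    have := hA.card_pos
    omega
  | succ n ih =>
    intro A B h ⟨a₀, ha₀⟩ ⟨b₀, hb₀⟩
    let H : Subgroup (FreeGroup α) :=
      Subgroup.closure (((A.image (a₀⁻¹ * ·)) ∪ (B.image (· * b₀⁻¹)) : Finset _) : Set _)
    have hAH : ∀ a ∈ A, a₀⁻¹ * a ∈ H := fun a ha => Subgroup.subset_closure (by
      simp only [Finset.coe_union, Finset.coe_image]
      exact Or.inl ⟨a, ha, rfl⟩)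
    have hBH : ∀ b ∈ B, b * b₀⁻¹ ∈ H := fun b hb => Subgroup.subset_closure (by
      simp only [Finset.coe_union, Finset.coe_image]
      exact Or.inr ⟨b, hb, rfl⟩)
    by_cases hH : H = ⊥
    · have h1 : ∀ a ∈ A, a = a₀ := fun a ha => by
        have := hAH a ha
        rw [hH, Subgroup.mem_bot, inv_mul_eq_one] at this
        exact this.symm
      have h2 : ∀ b ∈ B, b = b₀ := fun b hb => by
        have := hBH b hb
        rwa [hH, Subgroup.mem_bot, mul_inv_eq_one] at this
      exact ⟨a₀, ha₀, b₀, hb₀, fun a b ha hb _ => ⟨h1 a ha, h2 b hb⟩⟩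
    · obtain ⟨F, hF, x, hxH, hx⟩ := FreeGroup.exists_additive_on_subgroup H hH
      have hF1 : F 1 = 0 := by
        have := hF 1 H.one_mem 1 H.one_mem
        simpa using this
      obtain ⟨a₁, ha₁, hmaxA⟩ := A.exists_max_image (fun a => F (a₀⁻¹ * a)) ⟨a₀, ha₀⟩
      obtain ⟨b₁, hb₁, hmaxB⟩ := B.exists_max_image (fun b => F (b * b₀⁻¹)) ⟨b₀, hb₀⟩
      let A' := A.filter (fun a => F (a₀⁻¹ * a) = F (a₀⁻¹ * a₁))
      let B' := B.filter (fun b => F (b * b₀⁻¹) = F (b₁ * b₀⁻¹))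
      have hlt : A'.card + B'.card ≤ n := by
        have hA'le : A'.card ≤ A.card := Finset.card_filter_le _ _
        have hB'le : B'.card ≤ B.card := Finset.card_filter_le _ _
        by_contra hcon
        have hA'e : A' = A := Finset.eq_of_subset_of_card_le (Finset.filter_subset _ _) (by omega)
        have hB'e : B' = B := Finset.eq_of_subset_of_card_le (Finset.filter_subset _ _) (by omega)
        have hA0 : ∀ a ∈ A, F (a₀⁻¹ * a) = 0 := by
          intro a ha
          have e0 := (Finset.mem_filter.1 (hA'e.symm ▸ ha₀ : a₀ ∈ A')).2
          have e1 := (Finset.mem_filter.1 (hA'e.symm ▸ ha : a ∈ A')).2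
          rw [e1, ← e0, inv_mul_cancel, hF1]
        have hB0 : ∀ b ∈ B, F (b * b₀⁻¹) = 0 := by
          intro b hb
          have e0 := (Finset.mem_filter.1 (hB'e.symm ▸ hb₀ : b₀ ∈ B')).2
          have e1 := (Finset.mem_filter.1 (hB'e.symm ▸ hb : b ∈ B')).2
          rw [e1, ← e0, mul_inv_cancel, hF1]
        have hall : ∀ y ∈ H, F y = 0 := by
          intro y hy
          refine Subgroup.closure_induction (p := fun y _ => F y = 0) ?_ hF1 ?_ ?_ hy
          · intro y hy
            simp only [Finset.coe_union, Finset.coe_image] at hy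
            rcases hy with ⟨a, ha, rfl⟩ | ⟨b, hb, rfl⟩
            · exact hA0 a ha
            · exact hB0 b hb
          · intro y z hy hz e1 e2
            rw [hF y hy z hz, e1, e2, add_zero]
          · intro y hy e
            have := hF y hy y⁻¹ (H.inv_mem hy)
            rw [mul_inv_cancel, hF1, e] at this
            omega
        exact hx (hall x hxH)
      obtain ⟨a, ha, b, hb, hu⟩ := ih A' B' hlt
        ⟨a₁, Finset.mem_filter.2 ⟨ha₁, rfl⟩⟩ ⟨b₁, Finset.mem_filter.2 ⟨hb₁, rfl⟩⟩
      obtain ⟨haA, haF⟩ := Finset.mem_filter.1 ha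
      obtain ⟨hbB, hbF⟩ := Finset.mem_filter.1 hb
      refine ⟨a, haA, b, hbB, fun a' b' ha' hb' hab => ?_⟩
      have e : F (a₀⁻¹ * a') + F (b' * b₀⁻¹) = F (a₀⁻¹ * a) + F (b * b₀⁻¹) := by
        rw [← hF _ (hAH _ ha') _ (hBH _ hb'), ← hF _ (hAH _ haA) _ (hBH _ hbB)]
        congr 1
        calc a₀⁻¹ * a' * (b' * b₀⁻¹) = a₀⁻¹ * (a' * b') * b₀⁻¹ := by group
          _ = _ := by rw [hab]; group
      have m1 := hmaxA a' ha'
      have m2 := hmaxB b' hb'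
      exact hu (Finset.mem_filter.2 ⟨ha', by omega⟩) (Finset.mem_filter.2 ⟨hb', by omega⟩) hab

instance FreeGroup.instUniqueProds {α : Type*} : UniqueProds (FreeGroup α) where
  uniqueMul_of_nonempty {A B} hA hB := FreeGroup.exists_uniqueMul _ A B le_rfl hA hB

/-- Over a domain, the units of the group ring of a group with unique products are trivial. -/
theorem MonoidAlgebra.exists_unique_coeff {K G : Type*} [CommRing K] [IsDomain K] [Group G]
    [UniqueProds G] (c d : MonoidAlgebra K G) (h : d * c = 1) :
    ∃ g : G, c.coeff g ≠ 0 ∧ d.coeff g⁻¹ ≠ 0 ∧ (∀ x, c.coeff x ≠ 0 → x = g) ∧ (∀ x, d.coeff x ≠ 0 → x = g⁻¹) := by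
  classical
  have : TwoUniqueProds G := UniqueProds.toTwoUniqueProds_of_group
  have hc : c ≠ 0 := by rintro rfl; simp at h
  have hd : d ≠ 0 := by rintro rfl; simp at h
  -- At a unique product the coefficient of `d * c` is one product of nonzero elements; as `d * c =
  -- 1`, it must sit at the identity.
  have key : ∀ p : G × G, p.1 ∈ d.coeff.support → p.2 ∈ c.coeff.support →
      UniqueMul d.coeff.support c.coeff.support p.1 p.2 → p.1 * p.2 = 1 := by
    intro p hp1 hp2 hu
    by_contra hne
    have := MonoidAlgebra.coeff_mul_mul_of_uniqueMul hu
    rw [h, MonoidAlgebra.one_def, MonoidAlgebra.coeff_single, Finsupp.single_apply, if_neg (Ne.symm hne)] at this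
    exact mul_ne_zero (Finsupp.mem_support_iff.1 hp1) (Finsupp.mem_support_iff.1 hp2) this.symm
  -- Two distinct unique products would both equal the identity, contradicting the uniqueness of
  -- either.
  have hcard : d.coeff.support.card * c.coeff.support.card ≤ 1 := by
    by_contra hcon
    obtain ⟨p, hp, q, hq, hpq, up, uq⟩ :=
      TwoUniqueProds.uniqueMul_of_one_lt_card (not_le.1 hcon)
    rw [Finset.mem_product] at hp hq
    have e1 := key p hp.1 hp.2 up
    have e2 := key q hq.1 hq.2 uq
    obtain ⟨h1, h2⟩ := up hq.1 hq.2 (e2.trans e1.symm)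
    exact hpq (Prod.ext h1.symm h2.symm)
  have hcc : 0 < c.coeff.support.card := Finset.card_pos.2 (Finsupp.support_nonempty_iff.2 (MonoidAlgebra.coeff_eq_zero.not.2 hc))
  have hdc : 0 < d.coeff.support.card := Finset.card_pos.2 (Finsupp.support_nonempty_iff.2 (MonoidAlgebra.coeff_eq_zero.not.2 hd))
  have hc1 : c.coeff.support.card = 1 := by nlinarith
  have hd1 : d.coeff.support.card = 1 := by nlinarith
  obtain ⟨g, hg⟩ := Finset.card_eq_one.1 hc1
  obtain ⟨k, hk⟩ := Finset.card_eq_one.1 hd1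
  have hgm : g ∈ c.coeff.support := by simp [hg]
  have hkm : k ∈ d.coeff.support := by simp [hk]
  have hkg : k = g⁻¹ := by
    have := key (k, g) hkm hgm (by
      intro a b ha hb _
      rw [hk, Finset.mem_singleton] at ha
      rw [hg, Finset.mem_singleton] at hb
      exact ⟨ha, hb⟩)
    exact eq_inv_of_mul_eq_one_left this
  subst hkg
  refine ⟨g, Finsupp.mem_support_iff.1 hgm, Finsupp.mem_support_iff.1 hkm, ?_, ?_⟩
  · intro x hx
    have : x ∈ c.coeff.support := Finsupp.mem_support_iff.2 hx
    rwa [hg, Finset.mem_singleton] at this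
  · intro x hx
    have : x ∈ d.coeff.support := Finsupp.mem_support_iff.2 hx
    rwa [hk, Finset.mem_singleton] at this

/-! ### Approximating permutations by elements of a free group -/

/-- The free group on pairs, acting by transpositions. -/
abbrev SwapGroup : Type := FreeGroup (ℕ × ℕ)

/-- The action of the free group on `ℕ`: the generator `(i, j)` transposes `i` and `j`. -/
def SwapGroup.toPerm : SwapGroup →* Equiv.Perm ℕ :=
  FreeGroup.lift (fun p => Equiv.swap p.1 p.2)

/-- To correct the value at a new point, follow with the transposition of its present and its
desired image. By injectivity neither is among the values already settled. -/
theorem SwapGroup.exists_approx (σ : Equiv.Perm ℕ) (F : Finset ℕ) :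
    ∃ γ : SwapGroup, ∀ i ∈ F, SwapGroup.toPerm γ i = σ i := by
  classical
  induction F using Finset.induction_on with
  | empty => exact ⟨1, by simp⟩
  | insert a F ha ih =>
    obtain ⟨γ, hγ⟩ := ih
    refine ⟨FreeGroup.of (SwapGroup.toPerm γ a, σ a) * γ, fun i hi => ?_⟩
    have e : SwapGroup.toPerm (FreeGroup.of (SwapGroup.toPerm γ a, σ a)) =
      Equiv.swap (SwapGroup.toPerm γ a) (σ a) := FreeGroup.lift_apply_of
    rw [map_mul, Equiv.Perm.mul_apply, e]
    rcases Finset.mem_insert.1 hi with rfl | hi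
    · exact Equiv.swap_apply_left _ _
    · have hia : i ≠ a := fun h => ha (h ▸ hi)
      rw [hγ i hi]
      refine Equiv.swap_apply_of_ne_of_ne ?_ ?_
      · rw [← hγ i hi]
        exact fun h => hia ((SwapGroup.toPerm γ).injective h)
      · exact fun h => hia (σ.injective h)

/-- Elements of the free group agreeing with `σ` on larger and larger finite sets, in both
directions. -/
theorem SwapGroup.exists_seq_approx (σ : Equiv.Perm ℕ) :
    ∃ γ : ℕ → SwapGroup, ∀ n, ∀ i < n, SwapGroup.toPerm (γ n) i = σ i ∧
      SwapGroup.toPerm (γ n)⁻¹ i = σ⁻¹ i := by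
  classical
  have : ∀ n : ℕ, ∃ γ : SwapGroup, ∀ i < n, SwapGroup.toPerm γ i = σ i ∧
      SwapGroup.toPerm γ⁻¹ i = σ⁻¹ i := by
    intro n
    -- Agreement on the preimages of `0, …, n - 1` makes the inverses agree on `0, …, n - 1`.
    obtain ⟨γ, hγ⟩ := SwapGroup.exists_approx σ
      (Finset.range n ∪ (Finset.range n).image (fun i => σ⁻¹ i))
    refine ⟨γ, fun i hi => ⟨hγ i (by simp [hi]), ?_⟩⟩
    have := hγ (σ⁻¹ i) (Finset.mem_union_right _
      (Finset.mem_image_of_mem _ (Finset.mem_range.2 hi)))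
    rw [map_inv, Equiv.Perm.inv_eq_iff_eq, this]
    exact (σ.apply_symm_apply i).symm
  choose γ hγ using this
  exact ⟨γ, hγ⟩

/-! ### A module with endomorphisms remembering a set of words up to permutation of letters -/

/-- Finite words in the alphabet `ℕ`, labelled by elements of `J`. -/
abbrev LabelledWord (J : Type*) : Type _ := J × List ℕ

namespace LabelledWord

variable {J : Type*}

/-- Apply a permutation to all letters of a word. -/
def move (σ : Equiv.Perm ℕ) (o : LabelledWord J) : LabelledWord J := (o.1, o.2.map σ)

@[simp] theorem move_one (o : LabelledWord J) : move 1 o = o := by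
  simp [move]

theorem move_mul (σ τ : Equiv.Perm ℕ) (o : LabelledWord J) :
    move (σ * τ) o = move σ (move τ o) := by
  simp [move]

@[simp] theorem move_inv_move (σ : Equiv.Perm ℕ) (o : LabelledWord J) :
    move σ⁻¹ (move σ o) = o := by
  rw [← move_mul, inv_mul_cancel, move_one]

@[simp] theorem move_move_inv (σ : Equiv.Perm ℕ) (o : LabelledWord J) :
    move σ (move σ⁻¹ o) = o := by
  rw [← move_mul, mul_inv_cancel, move_one]

/-- Permutations agreeing with `σ` on larger and larger sets of letters. -/
theorem exists_move_eq {τ : ℕ → Equiv.Perm ℕ} {σ : Equiv.Perm ℕ}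
    (h : ∀ i, ∃ N, ∀ n ≥ N, τ n i = σ i) (o : LabelledWord J) :
    ∃ N, ∀ n ≥ N, move (τ n) o = move σ o := by
  choose N hN using h
  -- The sum serves as an upper bound for the thresholds of all letters.
  refine ⟨(o.2.map N).sum, fun n hn => ?_⟩
  refine Prod.ext rfl (List.map_congr_left fun i hi => hN i n (le_trans ?_ hn))
  exact List.single_le_sum (by simp) _ (List.mem_map_of_mem hi)

end LabelledWord

/-- Basis of the module `WordModule`: for each `n` a copy of the free group, for each `n` a copy
of the set of words, and one further copy of the set of words. -/
inductive WordBasis (J : Type*) where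
  | grp (n : ℕ) (γ : SwapGroup)
  | pt (n : ℕ) (o : LabelledWord J)
  | cst (o : LabelledWord J)

/-- Names for the distinguished endomorphisms of `WordModule`. -/
inductive WordEndo (R J : Type*) where
  | projGrp (n : ℕ)
  | projPt (n : ℕ)
  | mulRight (δ : SwapGroup)
  | eval (o : LabelledWord J)
  | coef (a : R)

instance {J : Type*} [Countable J] : Countable (WordBasis J) := by
  refine Function.Injective.countable (β := (ℕ × SwapGroup) ⊕ (Option ℕ × LabelledWord J))
    (f := fun b => match b with
      | .grp n γ => Sum.inl (n, γ)
      | .pt n o => Sum.inr (some n, o)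
      | .cst o => Sum.inr (none, o)) ?_
  rintro (⟨n, γ⟩ | ⟨n, o⟩ | ⟨o⟩) (⟨n', γ'⟩ | ⟨n', o'⟩ | ⟨o'⟩) h <;> simp_all

instance {R J : Type*} [Countable R] [Countable J] : Countable (WordEndo R J) := by
  refine Function.Injective.countable (β := (ℕ ⊕ ℕ) ⊕ (SwapGroup ⊕ (LabelledWord J ⊕ R)))
    (f := fun b => match b with
      | .projGrp n => Sum.inl (Sum.inl n)
      | .projPt n => Sum.inl (Sum.inr n)
      | .mulRight δ => Sum.inr (Sum.inl δ)
      | .eval o => Sum.inr (Sum.inr (Sum.inl o))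
      | .coef a => Sum.inr (Sum.inr (Sum.inr a))) ?_
  rintro (n | n | δ | o | a) (n' | n' | δ' | o' | a') h <;> simp_all

/-- The free module on `WordBasis J`. -/
abbrev WordModule (R J : Type*) [Ring R] : Type _ := WordBasis J →₀ R

namespace WordModule

open LabelledWord Finsupp

variable {R J : Type*} [Ring R]

open Classical in
/-- The values of the distinguished endomorphisms on basis vectors. -/
noncomputable def endoBasis : WordEndo R J → WordBasis J → WordModule R J
  | .projGrp m, .grp n γ => if n = m then single (.grp n γ) 1 else 0
  | .projPt m, .pt n o => if n = m then single (.pt n o) 1 else 0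
  -- The single vector `cst o` is tied to every `pt m o` at once; together with finite supports this
  -- is what enforces convergence.
  | .projPt m, .cst o => single (.pt m o) 1
  | .mulRight δ, .grp n γ => single (.grp n (γ * δ)) 1
  | .eval o, .grp n γ => single (.pt n (move (SwapGroup.toPerm γ) o)) 1
  -- This multiplies coefficients by `a` on the right, hence is left linear; commuting with it
  -- forces central coefficients.
  | .coef a, b => single b a
  | _, _ => 0

/-- The distinguished endomorphisms. -/
noncomputable def endo (θ : WordEndo R J) : WordModule R J →ₗ[R] WordModule R J :=
  Finsupp.linearCombination R (endoBasis θ)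

@[simp] theorem endo_single (θ : WordEndo R J) (b : WordBasis J) (r : R) :
    endo θ (single b r) = r • endoBasis θ b := by
  simp [endo]

theorem endo_apply (θ : WordEndo R J) (h : WordModule R J) :
    endo θ h = h.sum fun b r => r • endoBasis θ b := rfl

/-- The submodule of vectors whose `cst`-coordinates outside of `S` vanish. -/
def ofSet (S : Set (LabelledWord J)) : Submodule R (WordModule R J) where
  carrier := {h | ∀ o ∉ S, h (.cst o) = 0}
  add_mem' := fun ha hb o ho => by simp [ha o ho, hb o ho]
  zero_mem' := fun _ _ => rfl
  smul_mem' := fun c h hh o ho => by simp [hh o ho]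

/-! #### Isomorphisms from permutations -/

section OfPerm

variable (g : ℕ → SwapGroup) (σ : Equiv.Perm ℕ)

/-- `g n` eventually agrees with `σ` on each word. -/
def Approx (J : Type*) (g : ℕ → SwapGroup) (σ : Equiv.Perm ℕ) : Prop :=
  ∀ o : LabelledWord J, ∃ N, ∀ n ≥ N, move (SwapGroup.toPerm (g n)) o = move σ o

variable {g σ} in
theorem Approx.mul {g' : ℕ → SwapGroup} {σ' : Equiv.Perm ℕ} (h : Approx J g σ)
    (h' : Approx J g' σ') : Approx J (g' * g) (σ' * σ) := by
  intro o
  obtain ⟨N, hN⟩ := h o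
  obtain ⟨N', hN'⟩ := h' (move σ o)
  refine ⟨max N N', fun n hn => ?_⟩
  rw [Pi.mul_apply, map_mul, move_mul, move_mul, hN n (le_trans (le_max_left _ _) hn),
    hN' n (le_trans (le_max_right _ _) hn)]

/-- The difference of the actions of `g n` and `σ` on the word `o`. -/
noncomputable def diff (R : Type*) [Ring R] (o : LabelledWord J) (n : ℕ) : WordModule R J :=
  single (.pt n (move (SwapGroup.toPerm (g n)) o)) 1 - single (.pt n (move σ o)) 1

variable {g σ}

theorem diff_sum_eq {o : LabelledWord J} {N M : ℕ}
    (hN : ∀ n ≥ N, move (SwapGroup.toPerm (g n)) o = move σ o) (hM : N ≤ M) :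
    ∑ n ∈ Finset.range N, diff g σ R o n = ∑ n ∈ Finset.range M, diff g σ R o n := by
  refine Finset.sum_subset (Finset.range_mono hM) fun n _ hn => ?_
  rw [diff, hN n (by simpa using hn), sub_self]

/-- The values on basis vectors of the automorphism given by an approximated permutation. -/
noncomputable def permBasis (h : Approx J g σ) : WordBasis J → WordModule R J
  | .grp n γ => single (.grp n (g n * γ)) 1
  | .pt n o => single (.pt n (move (SwapGroup.toPerm (g n)) o)) 1
  -- Commuting with `projPt m` requires the image to project to `pt m` of the word moved by `g m`,
  -- whereas `cst (move σ o)` projects to the word moved by `σ`. The term `diff` at `m` repairs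
  -- this, and it is zero for all large `m`.
  | .cst o => single (.cst (move σ o)) 1 + ∑ n ∈ Finset.range (h o).choose, diff g σ R o n

/-- The endomorphism given by an approximated permutation. -/
noncomputable def permMap (h : Approx J g σ) : WordModule R J →ₗ[R] WordModule R J :=
  Finsupp.linearCombination R (permBasis h)

@[simp] theorem permMap_grp (h : Approx J g σ) (n : ℕ) (γ : SwapGroup) :
    permMap (R := R) h (single (.grp n γ) 1) = single (.grp n (g n * γ)) 1 := by
  simp [permMap, permBasis]

@[simp] theorem permMap_pt (h : Approx J g σ) (n : ℕ) (o : LabelledWord J) :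
    permMap (R := R) h (single (.pt n o) 1) =
      single (.pt n (move (SwapGroup.toPerm (g n)) o)) 1 := by
  simp [permMap, permBasis]

/-- Terms beyond the chosen bound vanish, so any larger bound will do; several images can then be
compared with a common bound. -/
theorem permMap_cst (h : Approx J g σ) (o : LabelledWord J) :
    ∃ N₀, ∀ N ≥ N₀, permMap (R := R) h (single (.cst o) 1) =
      single (.cst (move σ o)) 1 + ∑ n ∈ Finset.range N, diff g σ R o n := by
  refine ⟨(h o).choose, fun N hN => ?_⟩
  rw [← diff_sum_eq (h o).choose_spec hN]
  simp [permMap, permBasis]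

theorem linearMap_ext {M : Type*} [AddCommGroup M] [Module R M] {f f' : WordModule R J →ₗ[R] M}
    (h : ∀ b, f (single b 1) = f' (single b 1)) : f = f' := by
  refine Finsupp.lhom_ext' fun b => LinearMap.ext_ring ?_
  simpa using h b

theorem permMap_comp {g' : ℕ → SwapGroup} {σ' : Equiv.Perm ℕ} (h : Approx J g σ)
    (h' : Approx J g' σ') :
    (permMap h') ∘ₗ (permMap h) = permMap (R := R) (h.mul h') := by
  refine linearMap_ext fun b => ?_
  rcases b with ⟨n, γ⟩ | ⟨n, o⟩ | o
  · simp [mul_assoc]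
  · simp [move_mul]
  · obtain ⟨N₁, h₁⟩ := permMap_cst (R := R) h o
    obtain ⟨N₂, h₂⟩ := permMap_cst (R := R) h' (move σ o)
    obtain ⟨N₃, h₃⟩ := permMap_cst (R := R) (h.mul h') o
    let N := max N₁ (max N₂ N₃)
    rw [LinearMap.comp_apply, h₁ N (by simp [N]), h₃ N (by simp [N]), map_add, h₂ N (by simp [N]),
      map_sum, move_mul, add_assoc, ← Finset.sum_add_distrib]
    congr 1
    -- The two differences telescope through the word moved by `σ` and then by `g' n`.
    refine Finset.sum_congr rfl fun n _ => ?_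
    simp [diff, move_mul]

theorem permMap_one (h : Approx J 1 1) : permMap (R := R) h = LinearMap.id := by
  refine linearMap_ext fun b => ?_
  rcases b with ⟨n, γ⟩ | ⟨n, o⟩ | o
  · simp
  · simp
  · obtain ⟨N, hN⟩ := permMap_cst (R := R) h o
    rw [hN N le_rfl]
    simp [diff]

theorem permMap_endo (h : Approx J g σ) (θ : WordEndo R J) :
    (permMap h) ∘ₗ (endo θ) = (endo θ) ∘ₗ (permMap h) := by
  classical
  refine linearMap_ext fun b => ?_
  simp only [LinearMap.comp_apply]
  rcases b with ⟨n, γ⟩ | ⟨n, o⟩ | o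
  · cases θ with
    | projGrp m => by_cases hn : n = m <;> simp [endoBasis, hn]
    | projPt m => simp [endoBasis]
    | mulRight δ => simp [endoBasis, mul_assoc]
    | eval o => simp [endoBasis, move_mul]
    | coef a =>
      have : (single (WordBasis.grp n γ) a : WordModule R J) = a • single (.grp n γ) 1 := by simp
      simp only [endoBasis, permMap_grp, endo_single, one_smul]
      rw [this, map_smul]
      simp
  · cases θ with
    | projGrp m => simp [endoBasis]
    | projPt m => by_cases hn : n = m <;> simp [endoBasis, hn]
    | mulRight δ => simp [endoBasis]
    | eval o => simp [endoBasis]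
    | coef a =>
      have : (single (WordBasis.pt n o) a : WordModule R J) = a • single (.pt n o) 1 := by simp
      simp only [endoBasis, permMap_pt, endo_single, one_smul]
      rw [this, map_smul]
      simp
  · obtain ⟨N, hN⟩ := permMap_cst (R := R) h o
    cases θ with
    | projGrp m => rw [hN N le_rfl]; simp [endoBasis, diff]
    | projPt m =>
      rw [hN (max N (m + 1)) (le_max_left _ _)]
      simp only [endoBasis, endo_single, one_smul, permMap_pt, map_add, map_sum, diff, map_sub]
      rw [Finset.sum_eq_single m]
      · simp
      · intro n _ hn
        simp [hn]
      · intro hm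
        simp at hm
    | mulRight δ => rw [hN N le_rfl]; simp [endoBasis, diff]
    | eval o => rw [hN N le_rfl]; simp [endoBasis, diff]
    | coef a =>
      have e : (single (WordBasis.cst o) a : WordModule R J) = a • single (.cst o) 1 := by simp
      simp only [endoBasis, endo_single, one_smul]
      rw [e, map_smul, hN N le_rfl]
      simp [endoBasis, diff, Finset.smul_sum, smul_sub]

/-- The corrections lie on `pt`-vectors and do not disturb the `cst`-coordinates. -/
theorem permMap_apply_cst (h : Approx J g σ) (v : WordModule R J) (o : LabelledWord J) :
    permMap h v (.cst (move σ o)) = v (.cst o) := by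
  classical
  suffices hs : (Finsupp.lapply (R := R) (.cst (move σ o))) ∘ₗ (permMap (R := R) h) =
      Finsupp.lapply (.cst o) from LinearMap.congr_fun hs v
  refine linearMap_ext fun b => ?_
  rcases b with ⟨n, γ⟩ | ⟨n, o'⟩ | o'
  · simp
  · simp
  · obtain ⟨N, hN⟩ := permMap_cst (R := R) h o'
    have hinj : move σ o' = move σ o ↔ o' = o :=
      ⟨fun e => by simpa using congrArg (move σ⁻¹) e, fun e => e ▸ rfl⟩
    simp [hN N le_rfl, diff, Finsupp.single_apply, hinj]

theorem permMap_mem_ofSet (h : Approx J g σ) {S S' : Set (LabelledWord J)}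
    (hS : ∀ o, o ∈ S ↔ move σ o ∈ S') {v : WordModule R J} (hv : v ∈ ofSet S) :
    permMap h v ∈ ofSet S' := by
  intro o ho
  have e := permMap_apply_cst h v (move σ⁻¹ o)
  rw [move_move_inv] at e
  rw [e]
  refine hv _ fun hmem => ho ?_
  simpa using (hS _).1 hmem

end OfPerm

/-- A permutation of the letters carrying `S` to `S'` induces an automorphism carrying `ofSet S` to
`ofSet S'` and commuting with the distinguished endomorphisms. -/
theorem exists_equiv_of_perm (R : Type*) [Ring R] {S S' : Set (LabelledWord J)}
    (σ : Equiv.Perm ℕ) (hS : ∀ o, o ∈ S ↔ move σ o ∈ S') :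
    ∃ φ : WordModule R J ≃ₗ[R] WordModule R J,
      (∀ θ v, φ (endo θ v) = endo θ (φ v)) ∧ ∀ v, v ∈ ofSet S ↔ φ v ∈ ofSet S' := by
  obtain ⟨g, hg⟩ := SwapGroup.exists_seq_approx σ
  have h : Approx J g σ :=
    exists_move_eq (τ := fun n => SwapGroup.toPerm (g n)) fun i =>
      ⟨i + 1, fun n hn => (hg n i (by omega)).1⟩
  have h' : Approx J g⁻¹ σ⁻¹ :=
    exists_move_eq (τ := fun n => SwapGroup.toPerm (g n)⁻¹) fun i =>
      ⟨i + 1, fun n hn => (hg n i (by omega)).2⟩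
  have e₁ : (permMap h') ∘ₗ (permMap h) = (LinearMap.id : WordModule R J →ₗ[R] _) := by
    rw [permMap_comp]
    convert permMap_one (R := R) (J := J) _ using 2 <;> simp [Approx]
  have e₂ : (permMap h) ∘ₗ (permMap h') = (LinearMap.id : WordModule R J →ₗ[R] _) := by
    rw [permMap_comp]
    convert permMap_one (R := R) (J := J) _ using 2 <;> simp [Approx]
  refine ⟨LinearEquiv.ofLinearMap (permMap h) (permMap h') e₂ e₁,
    fun θ v => LinearMap.congr_fun (permMap_endo h θ) v, fun v => ⟨permMap_mem_ofSet h hS, ?_⟩⟩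
  intro hv
  have := permMap_mem_ofSet h' (S := S') (S' := S) (fun o => by rw [hS]; simp) hv
  have e := LinearMap.congr_fun e₁ v
  simp only [LinearMap.comp_apply, LinearMap.id_apply] at e
  rw [← e]
  exact this

end WordModule

/-! ### From automorphisms back to permutations -/

namespace WordModule

open LabelledWord Finsupp

/-- A map to a field that is a ring homomorphism on the center. -/
theorem exists_center_map.{w} (R : Type w) [Ring R] [Nontrivial R] :
    ∃ (K : Type w) (_ : Field K) (κ : R → K), κ 0 = 0 ∧ κ 1 = 1 ∧
      (∀ x ∈ Subring.center R, ∀ y ∈ Subring.center R, κ (x * y) = κ x * κ y) ∧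
      ∀ (ι : Type) (s : Finset ι) (x : ι → R), (∀ i ∈ s, x i ∈ Subring.center R) →
        κ (∑ i ∈ s, x i) = ∑ i ∈ s, κ (x i) := by
  classical
  obtain ⟨I, hI⟩ := Ideal.exists_maximal (Subring.center R)
  -- The value `0` off the center is a mere convention: `κ` is only used on central elements.
  let κ : R → Subring.center R ⧸ I := fun x =>
    if h : x ∈ Subring.center R then Ideal.Quotient.mk I ⟨x, h⟩ else 0
  have hκ : ∀ x (h : x ∈ Subring.center R), κ x = Ideal.Quotient.mk I ⟨x, h⟩ :=
    fun x h => dif_pos h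
  have hκ0 : κ 0 = 0 := by
    rw [hκ 0 (zero_mem _)]
    exact map_zero (Ideal.Quotient.mk I)
  refine ⟨Subring.center R ⧸ I, Ideal.Quotient.field I, κ, hκ0, ?_, ?_, ?_⟩
  · rw [hκ 1 (one_mem _)]
    exact map_one (Ideal.Quotient.mk I)
  · intro x hx y hy
    rw [hκ x hx, hκ y hy, hκ _ (mul_mem hx hy)]
    exact map_mul (Ideal.Quotient.mk I) ⟨x, hx⟩ ⟨y, hy⟩
  · intro ι s x
    induction s using Finset.induction_on with
    | empty => exact fun _ => hκ0
    | insert i s hi ih =>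
      intro hx
      have h1 := hx i (Finset.mem_insert_self _ _)
      have h2 : ∀ j ∈ s, x j ∈ Subring.center R := fun j hj => hx j (Finset.mem_insert_of_mem hj)
      rw [Finset.sum_insert hi, Finset.sum_insert hi, ← ih h2, hκ _ h1, hκ _ (sum_mem h2),
        hκ _ (add_mem h1 (sum_mem h2))]
      exact map_add (Ideal.Quotient.mk I) ⟨x i, h1⟩ ⟨_, sum_mem h2⟩

variable {R J : Type*} [Ring R]

theorem endo_projGrp_apply_eq_zero {n : ℕ} (v : WordModule R J) {b : WordBasis J}
    (hb : ∀ γ, b ≠ .grp n γ) : endo (.projGrp n) v b = 0 := by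
  classical
  rw [endo_apply, Finsupp.sum_apply]
  refine Finset.sum_eq_zero fun b' _ => ?_
  rcases b' with ⟨m, γ⟩ | ⟨m, o⟩ | o
  · simp only [endoBasis]
    split_ifs with hm
    · subst hm
      rw [Finsupp.smul_apply, Finsupp.single_apply, if_neg (hb γ).symm, smul_zero]
    · simp
  · simp [endoBasis]
  · simp [endoBasis]

/-- The coefficients of the image of the unit of the `n`-th copy of the free group. -/
noncomputable def grpCoeff (φ : WordModule R J →ₗ[R] WordModule R J) (n : ℕ) : SwapGroup →₀ R :=
  (φ (single (.grp n 1) 1)).comapDomain (.grp n) (fun _ _ _ _ h => by injection h)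

section Commuting

variable {φ : WordModule R J →ₗ[R] WordModule R J} (hφ : ∀ θ v, φ (endo θ v) = endo θ (φ v))
include hφ

/-- Commuting with `projGrp n` confines the image of the unit vector to the `n`-th copy, and
commuting with right translations determines the other images. So `φ` acts as left multiplication by
`grpCoeff φ n`. -/
theorem apply_grp (n : ℕ) (δ : SwapGroup) :
    φ (single (.grp n δ) 1) =
      (grpCoeff φ n).sum fun γ r => single (.grp n (γ * δ)) r := by
  classical
  have h1 : φ (single (.grp n 1) 1) = (grpCoeff φ n).sum fun γ r => single (.grp n γ) r := by
    ext b
    have e := hφ (.projGrp n) (single (.grp n 1) 1)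
    simp only [endo_single, endoBasis, if_true, one_smul] at e
    rw [Finsupp.sum_apply]
    rcases b with ⟨m, γ⟩ | ⟨m, o⟩ | o
    · by_cases hm : m = n
      · subst hm
        have : (fun γ' (r : R) => (single (WordBasis.grp (J := J) m γ') r) (WordBasis.grp m γ)) =
          fun γ' r => (single γ' r) γ := by
          funext γ' r
          simp [Finsupp.single_apply]
        rw [this, ← Finsupp.sum_apply, Finsupp.sum_single]
        rfl
      · rw [e, endo_projGrp_apply_eq_zero]
        · refine (Finset.sum_eq_zero fun γ' _ => ?_).symm
          beta_reduce
          rw [Finsupp.single_apply, if_neg]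
          intro h
          injection h with h
          exact hm h.symm
        · intro γ' h
          injection h with h
          exact hm h
    all_goals
      rw [e, endo_projGrp_apply_eq_zero]
      · refine (Finset.sum_eq_zero fun γ' _ => ?_).symm
        beta_reduce
        rw [Finsupp.single_apply, if_neg]
        simp
      · simp
  have e := hφ (.mulRight δ) (single (.grp n 1) 1)
  simp only [endo_single, endoBasis, one_smul, one_mul] at e
  rw [e, h1, map_finsuppSum]
  simp [endoBasis]

theorem apply_pt (n : ℕ) (o : LabelledWord J) :
    φ (single (.pt n o) 1) =
      (grpCoeff φ n).sum fun γ r => single (.pt n (move (SwapGroup.toPerm γ) o)) r := by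
  have e := hφ (.eval o) (single (.grp n 1) 1)
  simp only [endo_single, endoBasis, one_smul, map_one, move_one] at e
  rw [e, apply_grp hφ, map_finsuppSum]
  simp [endoBasis]

/-- On a basis vector `coef a` agrees with the scalar `a`. Linearity multiplies the coefficients of
the image by `a` on the left, commutation on the right. -/
theorem grpCoeff_mem_center (n : ℕ) (γ : SwapGroup) : grpCoeff φ n γ ∈ Subring.center R := by
  classical
  rw [Subring.mem_center_iff]
  intro a
  have e := hφ (.coef a) (single (.grp n 1) 1)
  have ha : endo (.coef a) (single (WordBasis.grp (J := J) n 1) (1 : R)) =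
      a • single (.grp n 1) 1 := by simp [endoBasis]
  rw [ha, map_smul, endo_apply] at e
  have e' := DFunLike.congr_fun e (.grp n γ)
  rw [Finsupp.sum_apply] at e'
  simp only [Finsupp.smul_apply, smul_eq_mul, endoBasis, Finsupp.single_apply, mul_ite,
    mul_zero] at e'
  rw [Finsupp.sum_ite_eq'] at e'
  have e'' : a * grpCoeff φ n γ = _ := e'
  rw [e'']
  split_ifs with h
  · rfl
  · have : φ (single (.grp n 1) 1) (.grp n γ) = 0 := Finsupp.notMem_support_iff.1 h
    change grpCoeff φ n γ = 0 at this
    rw [this, zero_mul]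

/-- `projPt n` adds up the coordinates at `pt n o'` and `cst o'`; commutation compares this sum with
the image of `pt n o`. -/
theorem apply_cst (n : ℕ) (o o' : LabelledWord J) :
    φ (single (.cst o) 1) (.pt n o') + φ (single (.cst o) 1) (.cst o') =
      φ (single (.pt n o) 1) (.pt n o') := by
  classical
  have e := hφ (.projPt n) (single (.cst o) 1)
  simp only [endo_single, endoBasis, one_smul] at e
  rw [e]
  generalize φ (single (.cst o) 1) = v
  have : (Finsupp.lapply (R := R) (.pt n o')) ∘ₗ (endo (R := R) (J := J) (.projPt n)) =
      Finsupp.lapply (.pt n o') + Finsupp.lapply (.cst o') := by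
    refine linearMap_ext fun b => ?_
    rcases b with ⟨m, γ⟩ | ⟨m, p⟩ | p
    · simp [endoBasis]
    · by_cases hm : m = n
      · subst hm
        simp [endoBasis]
      · simp [endoBasis, hm]
    · simp [endoBasis, Finsupp.single_apply]
  exact (LinearMap.congr_fun this v).symm

end Commuting

theorem exists_forall_pt_eq_zero (v : WordModule R J) : ∃ N, ∀ n ≥ N, ∀ o, v (.pt n o) = 0 := by
  classical
  refine ⟨(v.support.sup fun b => match b with | .pt n _ => n + 1 | _ => 0), fun n hn o => ?_⟩
  by_contra h
  have := Finset.le_sup (f := fun b : WordBasis J => match b with | .pt n _ => n + 1 | _ => 0)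
    (Finsupp.mem_support_iff.2 h)
  simp only at this
  omega

/-- If the coefficients `grpCoeff φ n` are, modulo a maximal ideal, concentrated at `g n`, then
`g n` is eventually constant on each word, the limit being visible in the values of `φ` on the
vectors `cst o`. -/
theorem exists_limit {K : Type*} [Field K] {κ : R → K} (h0 : κ 0 = 0)
    (hsum : ∀ (ι : Type) (s : Finset ι) (x : ι → R), (∀ i ∈ s, x i ∈ Subring.center R) →
        κ (∑ i ∈ s, x i) = ∑ i ∈ s, κ (x i))
    {φ : WordModule R J →ₗ[R] WordModule R J} (hφ : ∀ θ v, φ (endo θ v) = endo θ (φ v))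
    {g : ℕ → SwapGroup} (hg : ∀ n, κ (grpCoeff φ n (g n)) ≠ 0)
    (hg' : ∀ n γ, κ (grpCoeff φ n γ) ≠ 0 → γ = g n) (o : LabelledWord J) :
    ∃ o', (∃ N, ∀ n ≥ N, move (SwapGroup.toPerm (g n)) o = o') ∧
      φ (single (.cst o) 1) (.cst o') ≠ 0 := by
  classical
  -- Past `N` the `pt n` coordinates vanish, so the `cst` coordinate, which does not depend on `n`,
  -- is the coefficient of `φ (pt n o)`; under `κ` only `g n` contributes to it.
  obtain ⟨N, hN⟩ := exists_forall_pt_eq_zero (φ (single (.cst o) 1))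
  have key : ∀ n ≥ N, ∀ o', κ (φ (single (.cst o) 1) (.cst o')) =
      if move (SwapGroup.toPerm (g n)) o = o' then κ (grpCoeff φ n (g n)) else 0 := by
    intro n hn o'
    have e := apply_cst hφ n o o'
    rw [hN n hn, zero_add, apply_pt hφ, Finsupp.sum_apply, Finsupp.sum] at e
    rw [e, hsum]
    · rw [Finset.sum_eq_single (g n)]
      · rw [Finsupp.single_apply]
        simp only [WordBasis.pt.injEq, true_and]
        split_ifs
        · rfl
        · exact h0
      · intro γ _ hγ
        rw [Finsupp.single_apply]
        split_ifs
        · by_contra hne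
          exact hγ (hg' n γ hne)
        · exact h0
      · intro hmem
        exact absurd (by rw [Finsupp.notMem_support_iff.1 hmem, h0]) (hg n)
    · intro γ _
      rw [Finsupp.single_apply]
      split_ifs
      · exact grpCoeff_mem_center hφ n γ
      · exact zero_mem _
  have hne : κ (φ (single (.cst o) 1) (.cst (move (SwapGroup.toPerm (g N)) o))) ≠ 0 := by
    rw [key N le_rfl, if_pos rfl]
    exact hg N
  refine ⟨move (SwapGroup.toPerm (g N)) o, ⟨N, fun n hn => ?_⟩, fun h => hne (by rw [h, h0])⟩
  by_contra hcon
  rw [key n hn, if_neg hcon] at hne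
  exact hne rfl

/-- An automorphism commuting with the distinguished endomorphisms and carrying `ofSet S` to
`ofSet S'` induces a permutation of the letters carrying `S` to `S'`. -/
theorem exists_perm_of_equiv [Nontrivial R] [Nonempty J] {S S' : Set (LabelledWord J)}
    (φ : WordModule R J ≃ₗ[R] WordModule R J) (hφ : ∀ θ v, φ (endo θ v) = endo θ (φ v))
    (hS : ∀ v, v ∈ ofSet S ↔ φ v ∈ ofSet S') :
    ∃ σ : Equiv.Perm ℕ, ∀ o, o ∈ S ↔ move σ o ∈ S' := by
  classical
  obtain ⟨K, _, κ, h0, h1, hmul, hsum⟩ := exists_center_map R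
  have hψ : ∀ θ v, φ.symm (endo θ v) = endo θ (φ.symm v) := fun θ v => by
    rw [LinearEquiv.symm_apply_eq, hφ, LinearEquiv.apply_symm_apply]
  let c : ℕ → SwapGroup →₀ R := grpCoeff φ.toLinearMap
  let d : ℕ → SwapGroup →₀ R := grpCoeff φ.symm.toLinearMap
  have hc : ∀ n γ, c n γ ∈ Subring.center R := grpCoeff_mem_center (φ := φ.toLinearMap) hφ
  have hd : ∀ n γ, d n γ ∈ Subring.center R := grpCoeff_mem_center (φ := φ.symm.toLinearMap) hψ
  -- Coefficients of `φ.symm (φ (grp n 1))`: the two convolution elements are inverse to each other.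
  -- Reduction by `κ` gives `d * c = 1` in a group algebra over a field.
  have hconv : ∀ n ε, (∑ γ ∈ (c n).support, ∑ δ ∈ (d n).support,
      if δ * γ = ε then c n γ * d n δ else 0) = if (1 : SwapGroup) = ε then 1 else 0 := by
    intro n ε
    have e : φ.symm (φ (single (.grp n 1) 1)) = single (.grp n 1) 1 := φ.symm_apply_apply _
    have e1 : φ (single (.grp n 1) 1) = _ := apply_grp (φ := φ.toLinearMap) hφ n 1
    have e2 : ∀ γ, φ.symm (single (.grp n γ) 1) = _ :=
      apply_grp (φ := φ.symm.toLinearMap) hψ n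
    rw [e1, map_finsuppSum] at e
    have e3 : ∀ γ (r : R), φ.symm (single (.grp n (γ * 1)) r) =
        (d n).sum fun δ s => single (.grp n (δ * γ)) (r * s) := by
      intro γ r
      have : (single (WordBasis.grp n (γ * 1)) r : WordModule R J) =
        r • single (.grp n γ) 1 := by simp
      rw [this, map_smul, e2, Finsupp.smul_sum]
      simp [d]
    simp only [e3] at e
    have e4 := DFunLike.congr_fun e (.grp n ε)
    simp only [Finsupp.sum, Finsupp.finsetSum_apply, Finsupp.single_apply, WordBasis.grp.injEq,
      true_and] at e4
    exact e4
  have hunit : ∀ n, ∃ g : SwapGroup, κ (c n g) ≠ 0 ∧ κ (d n g⁻¹) ≠ 0 ∧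
      (∀ x, κ (c n x) ≠ 0 → x = g) ∧ ∀ x, κ (d n x) ≠ 0 → x = g⁻¹ := by
    intro n
    refine MonoidAlgebra.exists_unique_coeff (MonoidAlgebra.ofCoeff ((c n).mapRange κ h0))
      (MonoidAlgebra.ofCoeff ((d n).mapRange κ h0)) ?_
    apply MonoidAlgebra.coeff_injective
    ext ε
    rw [MonoidAlgebra.coeff_mul, MonoidAlgebra.one_def, MonoidAlgebra.coeff_single,
      Finsupp.single_apply, Finsupp.sum_mapRange_index (by simp)]
    have := congrArg κ (hconv n ε)
    rw [hsum] at this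
    · rw [Finsupp.sum, Finset.sum_congr rfl (fun δ _ => Finsupp.sum_mapRange_index (by simp))]
      simp only [Finsupp.sum]
      rw [Finset.sum_comm]
      trans κ (if (1 : SwapGroup) = ε then 1 else 0)
      · rw [← this]
        refine Finset.sum_congr rfl fun γ _ => ?_
        rw [hsum]
        · refine Finset.sum_congr rfl fun δ _ => ?_
          split_ifs
          · rw [hmul _ (hc _ _) _ (hd _ _), mul_comm]
          · exact h0.symm
        · intro δ _
          split_ifs
          · exact mul_mem (hc _ _) (hd _ _)
          · exact zero_mem _
      · split_ifs
        · exact h1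
        · exact h0
    · intro γ _
      refine sum_mem fun δ _ => ?_
      split_ifs
      · exact mul_mem (hc _ _) (hd _ _)
      · exact zero_mem _
  choose g hg1 hg2 hg3 hg4 using hunit
  have hlim := exists_limit h0 hsum (φ := φ.toLinearMap) hφ hg1 hg3
  have hlim' := exists_limit h0 hsum (φ := φ.symm.toLinearMap) hψ (g := fun n => (g n)⁻¹) hg2 hg4
  obtain ⟨j⟩ := ‹Nonempty J›
  -- One-letter words with any label show the convergence on single letters.
  have hσ : ∀ i, ∃ i', ∃ N, ∀ n ≥ N, SwapGroup.toPerm (g n) i = i' := by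
    intro i
    obtain ⟨o', ⟨N, hN⟩, -⟩ := hlim (j, [i])
    refine ⟨SwapGroup.toPerm (g N) i, N, fun n hn => ?_⟩
    have := (hN n hn).trans (hN N le_rfl).symm
    simpa [move] using this
  have hσ' : ∀ i, ∃ i', ∃ N, ∀ n ≥ N, SwapGroup.toPerm (g n)⁻¹ i = i' := by
    intro i
    obtain ⟨o', ⟨N, hN⟩, -⟩ := hlim' (j, [i])
    refine ⟨SwapGroup.toPerm (g N)⁻¹ i, N, fun n hn => ?_⟩
    have := (hN n hn).trans (hN N le_rfl).symm
    simpa [move] using this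
  choose s hs using hσ
  choose s' hs' using hσ'
  let σ : Equiv.Perm ℕ :=
    { toFun := s
      invFun := s'
      left_inv := fun i => by
        obtain ⟨N, hN⟩ := hs i
        obtain ⟨N', hN'⟩ := hs' (s i)
        rw [← hN' (max N N') (le_max_right _ _), ← hN (max N N') (le_max_left _ _), map_inv]
        exact Equiv.symm_apply_apply _ _
      right_inv := fun i => by
        obtain ⟨N, hN⟩ := hs' i
        obtain ⟨N', hN'⟩ := hs (s' i)
        rw [← hN' (max N N') (le_max_right _ _), ← hN (max N N') (le_max_left _ _), map_inv]
        exact Equiv.apply_symm_apply _ _ }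
  have hmem : ∀ o, φ (single (.cst o) 1) (.cst (move σ o)) ≠ 0 := by
    intro o
    obtain ⟨o', ⟨N, hN⟩, hne⟩ := hlim o
    obtain ⟨M, hM⟩ := exists_move_eq (τ := fun n => SwapGroup.toPerm (g n)) (σ := σ) hs o
    rwa [← hN (max N M) (le_max_left _ _), hM (max N M) (le_max_right _ _)] at hne
  have hmem' : ∀ o, φ.symm (single (.cst o) 1) (.cst (move σ⁻¹ o)) ≠ 0 := by
    intro o
    obtain ⟨o', ⟨N, hN⟩, hne⟩ := hlim' o
    obtain ⟨M, hM⟩ := exists_move_eq (τ := fun n => SwapGroup.toPerm (g n)⁻¹) (σ := σ⁻¹) hs' o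
    rwa [← hN (max N M) (le_max_left _ _), hM (max N M) (le_max_right _ _)] at hne
  have hcst : ∀ (T : Set (LabelledWord J)), ∀ o ∈ T,
      (single (.cst o) 1 : WordModule R J) ∈ ofSet T := by
    intro T o ho o' ho'
    rw [Finsupp.single_apply, if_neg]
    intro h
    injection h with h
    exact ho' (h ▸ ho)
  refine ⟨σ, fun o => ⟨fun ho => ?_, fun ho => ?_⟩⟩
  · by_contra hcon
    exact hmem o ((hS _).1 (hcst S o ho) _ hcon)
  · by_contra hcon
    have h2 : φ.symm (single (.cst (move σ o)) 1) ∈ ofSet S := by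
      rw [hS, LinearEquiv.apply_symm_apply]
      exact hcst S' _ ho
    have := hmem' (move σ o)
    rw [move_inv_move] at this
    exact this (h2 _ hcon)

end WordModule

/-! ### Sequences as power series -/

namespace SeqModule

open Polynomial

variable {R V V' : Type*} [Ring R] [AddCommGroup V] [Module R V] [AddCommGroup V'] [Module R V']

/-- The shift of sequences, i.e. multiplication of power series by the variable. -/
def shift (R V : Type*) [Ring R] [AddCommGroup V] [Module R V] : (ℕ → V) →ₗ[R] (ℕ → V) where
  toFun f n := Nat.casesOn n 0 f
  map_add' f g := by
    funext n
    cases n <;> simp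
  map_smul' r f := by
    funext n
    cases n <;> simp

@[simp] theorem shift_zero (f : ℕ → V) : shift R V f 0 = 0 := rfl

@[simp] theorem shift_succ (f : ℕ → V) (n : ℕ) : shift R V f (n + 1) = f n := rfl

theorem aeval_comm {M M' : Type*} [AddCommGroup M] [Module R M] [AddCommGroup M'] [Module R M']
    (T : M →ₗ[R] M') (s : Module.End R M) (s' : Module.End R M') (h : ∀ v, T (s v) = s' (T v))
    (q : ℤ[X]) (v : M) : T (aeval s q v) = aeval s' q (T v) := by
  induction q using Polynomial.induction_on' with
  | add p q hp hq => simp [hp, hq]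
  | monomial n a =>
    have hn : ∀ v, T ((s ^ n) v) = (s' ^ n) (T v) := by
      induction n with
      | zero => simp
      | succ n ih => intro v; rw [pow_succ, pow_succ, Module.End.mul_apply, Module.End.mul_apply,
          ih, h]
    simp [aeval_monomial, hn, Module.End.mul_apply]

/-- The action of a polynomial on sequences. -/
noncomputable def act (R : Type*) {V : Type*} [Ring R] [AddCommGroup V] [Module R V] (q : ℤ[X]) :
    (ℕ → V) →ₗ[R] (ℕ → V) :=
  aeval (shift R V : Module.End R (ℕ → V)) q

theorem act_mul (p q : ℤ[X]) (f : ℕ → V) : act R (p * q) f = act R p (act R q f) := by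
  simp [act, Module.End.mul_apply]

theorem act_add (p q : ℤ[X]) (f : ℕ → V) : act R (p + q) f = act R p f + act R q f := by
  simp [act]

@[simp] theorem act_one (f : ℕ → V) : act R 1 f = f := by
  simp [act]

theorem act_shift (q : ℤ[X]) (f : ℕ → V) : act R q (shift R V f) = shift R V (act R q f) :=
  (aeval_comm (shift R V) (shift R V) (shift R V) (fun _ => rfl) q f).symm

theorem act_mem {N : Submodule R (ℕ → V)} (hN : ∀ f ∈ N, shift R V f ∈ N) (q : ℤ[X])
    {f : ℕ → V} (hf : f ∈ N) : act R q f ∈ N := by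
  have := aeval_comm N.subtype ((shift R V).restrict hN) (shift R V) (fun _ => rfl) q ⟨f, hf⟩
  rw [act]
  exact this ▸ Subtype.mem _

/-- Here `q = 1 + X * divX q`: the action is the identity plus a term that raises the order, whence
invertibility on all sequences. -/
theorem act_eq {q : ℤ[X]} (hq : q.coeff 0 = 1) (f : ℕ → V) :
    act R q f = f + shift R V (act R q.divX f) := by
  conv_lhs => rw [← divX_mul_X_add q, hq]
  rw [act_add, act_mul, map_one, act_one, add_comm, ← act_shift]
  congr 2
  simp [act]

/-- Sequences with values in `U`. -/
def full (U : Submodule R V) : Submodule R (ℕ → V) := Submodule.pi Set.univ fun _ => U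

theorem mem_full {U : Submodule R V} {f : ℕ → V} : f ∈ full U ↔ ∀ n, f n ∈ U := by
  simp [full]

/-- Finitely supported sequences with values in `U`. -/
def poly (U : Submodule R V) : Submodule R (ℕ → V) where
  carrier := {f | (∃ N, ∀ n ≥ N, f n = 0) ∧ ∀ n, f n ∈ U}
  add_mem' := by
    rintro f g ⟨⟨N, hN⟩, hf⟩ ⟨⟨N', hN'⟩, hg⟩
    exact ⟨⟨max N N', fun n hn => by simp [hN n (le_trans (le_max_left _ _) hn),
      hN' n (le_trans (le_max_right _ _) hn)]⟩, fun n => U.add_mem (hf n) (hg n)⟩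
  zero_mem' := ⟨⟨0, fun _ _ => rfl⟩, fun _ => U.zero_mem⟩
  smul_mem' := by
    rintro r f ⟨⟨N, hN⟩, hf⟩
    exact ⟨⟨N, fun n hn => by simp [hN n hn]⟩, fun n => U.smul_mem r (hf n)⟩

theorem mem_poly {U : Submodule R V} {f : ℕ → V} :
    f ∈ poly U ↔ (∃ N, ∀ n ≥ N, f n = 0) ∧ ∀ n, f n ∈ U := Iff.rfl

theorem poly_le_full (U : Submodule R V) : poly U ≤ full U := fun _ hf => mem_full.2 hf.2

theorem poly_le_poly_top (U : Submodule R V) : poly U ≤ poly ⊤ := fun _ hf => ⟨hf.1, fun _ => trivial⟩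

theorem shift_mem_full {U : Submodule R V} (f : ℕ → V) (hf : f ∈ full U) :
    shift R V f ∈ full U := by
  rw [mem_full] at hf ⊢
  intro n
  cases n with
  | zero => exact U.zero_mem
  | succ n => exact hf n

theorem shift_mem_poly {U : Submodule R V} (f : ℕ → V) (hf : f ∈ poly U) :
    shift R V f ∈ poly U := by
  obtain ⟨⟨N, hN⟩, hU⟩ := hf
  refine ⟨⟨N + 1, fun n hn => ?_⟩, mem_full.1 (shift_mem_full f (mem_full.2 hU))⟩
  obtain ⟨m, rfl⟩ : ∃ m, n = m + 1 := ⟨n - 1, by omega⟩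
  exact hN m (by omega)

/-- Sequences whose first `j` values are in `U`. -/
def initial (U : Submodule R V) (j : ℕ) : Submodule R (ℕ → V) := Submodule.pi {n | n < j} fun _ => U

theorem mem_initial {U : Submodule R V} {j : ℕ} {f : ℕ → V} :
    f ∈ initial U j ↔ ∀ n < j, f n ∈ U := by
  simp [initial]

theorem shift_mem_initial_succ {U : Submodule R V} {j : ℕ} {f : ℕ → V} (hf : f ∈ initial U j) :
    shift R V f ∈ initial U (j + 1) := by
  rw [mem_initial] at hf ⊢
  intro n hn
  cases n with
  | zero => exact U.zero_mem
  | succ n => exact hf n (by omega)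

theorem shift_mem_initial {U : Submodule R V} {j : ℕ} (f : ℕ → V) (hf : f ∈ initial U j) :
    shift R V f ∈ initial U j :=
  mem_initial.2 fun n hn => mem_initial.1 (shift_mem_initial_succ hf) n (by omega)

/-- If the first `j` values of `f` lie in `U`, then writing `f` as `q f` minus a shift extends this
to the first `j + 1`. -/
theorem mem_full_of_act {U : Submodule R V} {q : ℤ[X]} (hq : q.coeff 0 = 1) {f : ℕ → V}
    (h : act R q f ∈ full U) : f ∈ full U := by
  have key : ∀ j, f ∈ initial U j := by
    intro j
    induction j with
    | zero => exact mem_initial.2 fun n hn => absurd hn (by omega)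
    | succ j ih =>
      have e : f = act R q f - shift R V (act R q.divX f) := by
        rw [act_eq hq f, add_sub_cancel_right]
      rw [e]
      exact sub_mem (mem_initial.2 fun n _ => mem_full.1 h n)
        (shift_mem_initial_succ (act_mem shift_mem_initial _ ih))
  exact mem_full.2 fun n => mem_initial.1 (key (n + 1)) n (by omega)

theorem act_injective {q : ℤ[X]} (hq : q.coeff 0 = 1) : Injective (act R (V := V) q) := by
  rw [injective_iff_map_eq_zero]
  intro f hf
  have : f ∈ full (⊥ : Submodule R V) := mem_full_of_act hq (by rw [hf]; exact zero_mem _)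
  funext n
  simpa using mem_full.1 this n

/-- Successive approximations to a preimage of `g` under the action of `1 + X * r`. -/
noncomputable def approx (R : Type*) {V : Type*} [Ring R] [AddCommGroup V] [Module R V]
    (r : ℤ[X]) (g : ℕ → V) : ℕ → ℕ → V
  | 0 => 0
  | m + 1 => g - shift R V (act R r (approx R r g m))

theorem approx_sub_mem (r : ℤ[X]) (g : ℕ → V) (m : ℕ) :
    approx R r g (m + 1) - approx R r g m ∈ initial (⊥ : Submodule R V) m := by
  induction m with
  | zero => exact mem_initial.2 fun n hn => absurd hn (by omega)
  | succ m ih =>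
    have : approx R r g (m + 1 + 1) - approx R r g (m + 1) =
        - shift R V (act R r (approx R r g (m + 1) - approx R r g m)) := by
      rw [map_sub, map_sub]
      simp only [approx]
      abel
    rw [this]
    exact neg_mem (shift_mem_initial_succ (act_mem shift_mem_initial _ ih))

theorem act_surjective {q : ℤ[X]} (hq : q.coeff 0 = 1) : Surjective (act R (V := V) q) := by
  intro g
  let F := approx R q.divX g
  -- The iterates `F m` agree with all later ones below `m`, so the diagonal is their limit.
  let f : ℕ → V := fun j => F (j + 1) j
  have hF : ∀ k m, F (m + k) - F m ∈ initial (⊥ : Submodule R V) m := by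
    intro k m
    induction k with
    | zero => simp
    | succ k ih =>
      have := add_mem (mem_initial.2 fun n (hn : n < m) =>
        mem_initial.1 (approx_sub_mem (R := R) q.divX g (m + k)) n (by omega)) ih
      rwa [sub_add_sub_cancel] at this
  have hf : ∀ m, f - F m ∈ initial (⊥ : Submodule R V) m := by
    intro m
    rw [mem_initial]
    intro n hn
    obtain ⟨k, rfl⟩ : ∃ k, m = n + 1 + k := ⟨m - (n + 1), by omega⟩
    have := mem_initial.1 (hF k (n + 1)) n (by omega)
    rw [← neg_mem_iff]
    simpa [f] using this
  refine ⟨f, ?_⟩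
  rw [act_eq hq, ← sub_eq_zero]
  funext j
  have e : f + shift R V (act R q.divX f) - g =
      (f - F (j + 1)) + shift R V (act R q.divX (f - F j)) := by
    have : F (j + 1) = g - shift R V (act R q.divX (F j)) := rfl
    rw [this, map_sub, map_sub]
    abel
  rw [e]
  have := mem_initial.1 (add_mem (hf (j + 1))
    (shift_mem_initial_succ (act_mem shift_mem_initial q.divX (hf j)))) j (by omega)
  simpa using this

theorem shift_pow_apply_add (i n : ℕ) (f : ℕ → V) :
    ((shift R V : Module.End R (ℕ → V)) ^ i) f (n + i) = f n := by
  induction i with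
  | zero => simp
  | succ i ih =>
    rw [pow_succ', Module.End.mul_apply, ← add_assoc, shift_succ, ih]

/-- The leading coefficient contributes exactly `f j`; all other terms involve values of `f` at
places after `j`. -/
theorem act_monic_apply {U : Submodule R V} {P : ℤ[X]} (hP : P.Monic) {f : ℕ → V} {j : ℕ}
    (hf : ∀ n > j, f n ∈ U) : act R P f (j + P.natDegree) - f j ∈ U := by
  rw [act, aeval_eq_sum_range, LinearMap.sum_apply, Finset.sum_apply, Finset.sum_range_succ]
  simp only [LinearMap.smul_apply, Pi.smul_apply]
  rw [shift_pow_apply_add, hP.coeff_natDegree, one_smul, add_sub_cancel_right]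
  refine sum_mem fun i hi => zsmul_mem ?_ _
  rw [Finset.mem_range] at hi
  obtain ⟨k, hk⟩ : ∃ k, P.natDegree = k + 1 + i := ⟨P.natDegree - i - 1, by omega⟩
  rw [hk, ← add_assoc, shift_pow_apply_add]
  exact hf _ (by omega)

theorem mem_full_of_forall_pow {U : Submodule R V} {p : ℤ[X]} (hp : p.Monic)
    (hd : 0 < p.natDegree) {f : ℕ → V} (hf : f ∈ poly (⊤ : Submodule R V))
    (h : ∀ k, ∃ g ∈ poly (⊤ : Submodule R V), f - act R (p ^ k) g ∈ full U) : f ∈ full U := by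
  classical
  obtain ⟨⟨N, hN⟩, -⟩ := hf
  -- The degree of `p ^ N` is at least `N`, so the places `j + deg (p ^ N)` are past the support of
  -- `f`. Downward induction from the end of `g` then puts each value of `g` in `U`.
  obtain ⟨g, ⟨⟨M, hM⟩, -⟩, hg⟩ := h N
  have hgU : ∀ m j, j + m ≥ M → g j ∈ U := by
    intro m
    induction m with
    | zero =>
      intro j hj
      rw [hM j hj]
      exact U.zero_mem
    | succ m ih =>
      intro j hj
      have h1 := act_monic_apply (R := R) (hp.pow N) (j := j) (f := g) (U := U)
        fun n hn => ih n (by omega)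
      have h2 := mem_full.1 hg (j + (p ^ N).natDegree)
      have hle : N ≤ j + (p ^ N).natDegree := by
        rw [hp.natDegree_pow]
        nlinarith
      rw [Pi.sub_apply, hN _ hle, zero_sub, neg_mem_iff] at h2
      have := sub_mem h2 h1
      rwa [sub_sub_cancel] at this
  have hgf : g ∈ full U := mem_full.2 fun j => hgU M j (by omega)
  have := add_mem hg (act_mem shift_mem_full (p ^ N) hgf)
  rwa [sub_add_cancel] at this

end SeqModule

/-! ### Coding a countable family of submodules by one submodule -/

namespace SeqModule

open Polynomial

variable {R V V' I : Type*} [Ring R] [AddCommGroup V] [Module R V] [AddCommGroup V'] [Module R V']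

/-- Pairwise coprime monic polynomials of positive degree with constant coefficient one. -/
structure CoprimeFamily (p : I → ℤ[X]) : Prop where
  monic : ∀ i, (p i).Monic
  natDegree_pos : ∀ i, 0 < (p i).natDegree
  coeff_zero : ∀ i, (p i).coeff 0 = 1
  coprime : ∀ i j, i ≠ j → IsCoprime (p i) (p j)

/-- Polynomials `1 + X`, `1 + X (1 + X)`, ..., each next one being `1` plus `X` times the product
of the earlier ones. -/
noncomputable def euclidPoly (n : ℕ) : ℤ[X] :=
  1 + X * ∏ m : Fin n, euclidPoly m.1
decreasing_by exact m.2

/-- Euclid's argument: each earlier polynomial divides the later one minus `1`. -/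
theorem coprimeFamily_euclidPoly : CoprimeFamily euclidPoly := by
  have h0 : ∀ n, (euclidPoly n).coeff 0 = 1 := by
    intro n
    rw [euclidPoly]
    simp
  have hm : ∀ n, (euclidPoly n).Monic ∧ 0 < (euclidPoly n).natDegree := by
    intro n
    induction n using Nat.strong_induction_on with
    | _ n ih =>
      have hprod : (X * ∏ m : Fin n, euclidPoly m.1).Monic :=
        monic_X.mul (monic_prod_of_monic _ _ fun m _ => (ih m.1 m.2).1)
      have hdeg : 0 < (X * ∏ m : Fin n, euclidPoly m.1).natDegree := by
        rw [monic_X.natDegree_mul (monic_prod_of_monic _ _ fun m _ => (ih m.1 m.2).1)]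
        simp
      have hlt : (1 : ℤ[X]).degree < (X * ∏ m : Fin n, euclidPoly m.1).degree := by
        rw [degree_one]
        exact natDegree_pos_iff_degree_pos.1 hdeg
      rw [euclidPoly]
      exact ⟨hprod.add_of_right hlt, by
        rw [natDegree_add_eq_right_of_degree_lt hlt]
        exact hdeg⟩
  have hc : ∀ m n, m < n → IsCoprime (euclidPoly m) (euclidPoly n) := by
    intro m n hmn
    obtain ⟨c, hc⟩ : euclidPoly m ∣ X * ∏ k : Fin n, euclidPoly k.1 :=
      (Finset.dvd_prod_of_mem (fun k : Fin n => euclidPoly k.1)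
        (Finset.mem_univ (⟨m, hmn⟩ : Fin n))).mul_left _
    refine ⟨-c, 1, ?_⟩
    rw [euclidPoly.eq_1 n, hc]
    ring
  refine ⟨fun n => (hm n).1, fun n => (hm n).2, h0, fun i j hij => ?_⟩
  rcases lt_or_gt_of_ne hij with h | h
  · exact hc i j h
  · exact (hc j i h).symm

theorem exists_coprimeFamily (I : Type*) [Countable I] : ∃ p : I → ℤ[X], CoprimeFamily p := by
  obtain ⟨f, hf⟩ := Countable.exists_injective_nat I
  have h := coprimeFamily_euclidPoly
  exact ⟨euclidPoly ∘ f, fun _ => h.monic _, fun _ => h.natDegree_pos _, fun _ => h.coeff_zero _,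
    fun i j hij => h.coprime _ _ (hf.ne hij)⟩

/-- Sequences multiplied by a power of `p` into finite sequences in `U`. -/
def divided (p : ℤ[X]) (U : Submodule R V) : Submodule R (ℕ → V) where
  carrier := {f | ∃ k, act R (p ^ k) f ∈ poly U}
  add_mem' := by
    rintro f g ⟨k, hk⟩ ⟨l, hl⟩
    refine ⟨k + l, ?_⟩
    rw [map_add]
    refine add_mem ?_ ?_
    · rw [pow_add, mul_comm, act_mul]
      exact act_mem shift_mem_poly _ hk
    · rw [pow_add, act_mul]
      exact act_mem shift_mem_poly _ hl
  zero_mem' := ⟨0, by simp⟩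
  smul_mem' := by
    rintro r f ⟨k, hk⟩
    exact ⟨k, by rw [map_smul]; exact Submodule.smul_mem _ _ hk⟩

theorem mem_divided {p : ℤ[X]} {U : Submodule R V} {f : ℕ → V} :
    f ∈ divided p U ↔ ∃ k, act R (p ^ k) f ∈ poly U := Iff.rfl

theorem poly_le_divided (p : ℤ[X]) (U : Submodule R V) : poly U ≤ divided p U :=
  fun f hf => ⟨0, by simpa using hf⟩

theorem shift_mem_divided {p : ℤ[X]} {U : Submodule R V} (f : ℕ → V) (hf : f ∈ divided p U) :
    shift R V f ∈ divided p U := by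
  obtain ⟨k, hk⟩ := hf
  exact ⟨k, by rw [act_shift]; exact shift_mem_poly _ hk⟩

theorem coeff_zero_pow {p : ℤ[X]} (hp : p.coeff 0 = 1) (k : ℕ) : (p ^ k).coeff 0 = 1 := by
  rw [coeff_zero_eq_eval_zero, eval_pow, ← coeff_zero_eq_eval_zero, hp, one_pow]

theorem divided_le_full {p : ℤ[X]} (hp : p.coeff 0 = 1) (U : Submodule R V) :
    divided p U ≤ full U := by
  rintro f ⟨k, hk⟩
  exact mem_full_of_act (coeff_zero_pow hp k) (poly_le_full _ hk)

theorem exists_mem_divided_pow {p : ℤ[X]} (hp : p.coeff 0 = 1) {U : Submodule R V} {f : ℕ → V}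
    (hf : f ∈ divided p U) (k : ℕ) : ∃ g ∈ divided p U, act R (p ^ k) g = f := by
  obtain ⟨g, rfl⟩ := act_surjective (R := R) (coeff_zero_pow hp k) f
  obtain ⟨l, hl⟩ := hf
  exact ⟨g, ⟨l + k, by rwa [pow_add, act_mul]⟩, rfl⟩

/-- Rational power series: sequences multiplied into finite sequences by a polynomial with constant
coefficient one. -/
def rational (R V : Type*) [Ring R] [AddCommGroup V] [Module R V] : Submodule R (ℕ → V) where
  carrier := {f | ∃ q : ℤ[X], q.coeff 0 = 1 ∧ act R q f ∈ poly (⊤ : Submodule R V)}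
  add_mem' := by
    rintro f g ⟨q, hq, hf⟩ ⟨r, hr, hg⟩
    refine ⟨q * r, by rw [mul_coeff_zero, hq, hr, one_mul], ?_⟩
    rw [map_add]
    refine add_mem ?_ ?_
    · rw [mul_comm, act_mul]
      exact act_mem shift_mem_poly _ hf
    · rw [act_mul]
      exact act_mem shift_mem_poly _ hg
  zero_mem' := ⟨1, by simp, by simp⟩
  smul_mem' := by
    rintro r f ⟨q, hq, hf⟩
    exact ⟨q, hq, by rw [map_smul]; exact Submodule.smul_mem _ _ hf⟩

theorem shift_mem_rational (f : ℕ → V) (hf : f ∈ rational R V) : shift R V f ∈ rational R V := by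
  obtain ⟨q, hq, h⟩ := hf
  exact ⟨q, hq, by rw [act_shift]; exact shift_mem_poly _ h⟩

theorem divided_le_rational {p : ℤ[X]} (hp : p.coeff 0 = 1) (U : Submodule R V) :
    divided p U ≤ rational R V := by
  rintro f ⟨k, hk⟩
  exact ⟨p ^ k, coeff_zero_pow hp k, poly_le_poly_top _ hk⟩

/-- Finite sequences and integer polynomials are countable, and each `act R q` involved is
injective. The space of all sequences would be too large for universe `ℕ`. -/
instance [Countable V] : Countable (rational R V) := by
  have hpoly : (poly (⊤ : Submodule R V) : Set (ℕ → V)).Countable := by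
    refine (Set.countable_range (fun f : ℕ →₀ V => (f : ℕ → V))).mono ?_
    rintro f ⟨⟨N, hN⟩, -⟩
    refine ⟨Finsupp.ofSupportFinite f ((Set.finite_lt_nat N).subset fun n hn => ?_), rfl⟩
    by_contra hcon
    exact hn (hN n (not_lt.1 hcon))
  have : (rational R V : Set (ℕ → V)) ⊆ ⋃ q ∈ {q : ℤ[X] | q.coeff 0 = 1},
      (act R q) ⁻¹' (poly (⊤ : Submodule R V) : Set (ℕ → V)) := by
    rintro f ⟨q, hq, hf⟩
    exact Set.mem_biUnion hq hf
  refine Set.Countable.to_subtype (Set.Countable.mono this ?_)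
  have : Countable ℤ[X] := Function.Injective.countable
    (f := fun q : ℤ[X] => q.toFinsupp.coeff)
    (AddMonoidAlgebra.coeff_injective.comp Polynomial.toFinsupp_injective)
  exact (Set.to_countable _).biUnion fun q hq =>
    hpoly.preimage_of_injOn (act_injective hq).injOn

/-- The submodule of sequences coding a family of submodules of `V`. -/
def coded (p : I → ℤ[X]) (U : I → Submodule R V) : Submodule R (ℕ → V) :=
  ⨆ i, divided (p i) (U i)

section Coded

variable {p : I → ℤ[X]} {U : I → Submodule R V} {U' : I → Submodule R V'}

theorem divided_le_coded (p : I → ℤ[X]) (U : I → Submodule R V) (i : I) :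
    divided (p i) (U i) ≤ coded p U := le_iSup (fun i => divided (p i) (U i)) i

theorem coded_le_rational (hp : CoprimeFamily p) : coded p U ≤ rational R V :=
  iSup_le fun i => divided_le_rational (hp.coeff_zero i) _

theorem shift_mem_coded (f : ℕ → V) (hf : f ∈ coded p U) : shift R V f ∈ coded p U := by
  refine Submodule.iSup_induction (motive := fun f => shift R V f ∈ coded p U) _ hf ?_ ?_ ?_
  · exact fun i f hf => divided_le_coded p U i (shift_mem_divided f hf)
  · simp
  · intro f g hf hg
    rw [map_add]
    exact add_mem hf hg

/-- Components of index other than `i` are made finite by powers of polynomials coprime to `p i`;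
the component of index `i` already has its values in `U i`. -/
theorem exists_coprime_act (hp : CoprimeFamily p) (i : I) {w : ℕ → V} (hw : w ∈ coded p U) :
    ∃ q : ℤ[X], IsCoprime q (p i) ∧ q.coeff 0 = 1 ∧
      ∃ f ∈ poly (⊤ : Submodule R V), act R q w - f ∈ full (U i) := by
  refine Submodule.iSup_induction (motive := fun w => ∃ q : ℤ[X], IsCoprime q (p i) ∧
    q.coeff 0 = 1 ∧ ∃ f ∈ poly (⊤ : Submodule R V), act R q w - f ∈ full (U i)) _ hw ?_ ?_ ?_
  · intro j w hw
    by_cases hij : j = i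
    · subst hij
      exact ⟨1, isCoprime_one_left, by simp, 0, zero_mem _, by
        simpa using divided_le_full (hp.coeff_zero j) _ hw⟩
    · obtain ⟨k, hk⟩ := hw
      exact ⟨p j ^ k, (hp.coprime j i hij).pow_left, coeff_zero_pow (hp.coeff_zero j) k,
        _, poly_le_poly_top _ hk, by simp⟩
  · exact ⟨1, isCoprime_one_left, by simp, 0, zero_mem _, by simp⟩
  · rintro v w ⟨q, hq, hq0, f, hf, h⟩ ⟨r, hr, hr0, g, hg, h'⟩
    refine ⟨q * r, hq.mul_left hr, by rw [mul_coeff_zero, hq0, hr0, one_mul],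
      act R r f + act R q g, add_mem (act_mem shift_mem_poly _ hf) (act_mem shift_mem_poly _ hg), ?_⟩
    have := add_mem (act_mem shift_mem_full r h) (act_mem shift_mem_full q h')
    rw [map_sub, map_sub, ← act_mul, ← act_mul] at this
    rw [map_add]
    convert this using 1
    rw [mul_comm r q]
    abel

/-- Work modulo `U i`. Some `q w` is a finite sequence `f`. If `w = p i ^ k w'` and `q' w'` is a
finite `f'`, with `a q' + b p i ^ k = 1`, then `f` equals `p i ^ k (a q f' + b f)`. So `f` is
divisible by all powers of `p i` among finite sequences, hence zero, and `w` is zero because `q` has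
constant coefficient one. -/
theorem mem_of_divisible (hp : CoprimeFamily p) (i : I) {w : ℕ → V} (hw : w ∈ coded p U)
    (hdiv : ∀ k, ∃ w' ∈ coded p U, act R (p i ^ k) w' = w) (n : ℕ) : w n ∈ U i := by
  obtain ⟨q, -, hq0, f, hf, h⟩ := exists_coprime_act hp i hw
  have hfull : f ∈ full (U i) := by
    refine mem_full_of_forall_pow (hp.monic i) (hp.natDegree_pos i) hf fun k => ?_
    obtain ⟨w', hw', rfl⟩ := hdiv k
    obtain ⟨q', hq', -, f', hf', h'⟩ := exists_coprime_act hp i hw'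
    obtain ⟨a, b, hab⟩ : IsCoprime q' (p i ^ k) := hq'.pow_right
    refine ⟨act R a (act R q f') + act R b f, add_mem (act_mem shift_mem_poly _
      (act_mem shift_mem_poly _ hf')) (act_mem shift_mem_poly _ hf), ?_⟩
    have h1 := act_mem shift_mem_full (a * q') h
    have h2 := act_mem shift_mem_full (a * q * p i ^ k) h'
    have e : f = act R (a * q') f + act R (b * p i ^ k) f := by
      rw [← act_add, hab, act_one]
    have := sub_mem h2 h1
    convert this using 1
    refine (congrArg (fun x => x - act R (p i ^ k) (act R a (act R q f') + act R b f)) e).trans ?_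
    simp only [map_sub, map_add, ← act_mul]
    have e1 : a * q * p i ^ k * q' = a * q' * (q * p i ^ k) := by ring
    have e2 : p i ^ k * (a * q) = a * q * p i ^ k := by ring
    have e3 : p i ^ k * b = b * p i ^ k := by ring
    simp only [← mul_assoc] at e1 e2 e3 ⊢
    rw [e1, e2, e3]
    abel
  have := add_mem h hfull
  rw [sub_add_cancel] at this
  exact mem_full.1 (mem_full_of_act hq0 this) n

theorem poly_top_le_coded {i₀ i₁ : I} (hU : U i₀ ⊔ U i₁ = ⊤) :
    poly (⊤ : Submodule R V) ≤ coded p U := by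
  classical
  rintro f ⟨⟨N, hN⟩, -⟩
  have hs : ∀ v : V, ∃ u ∈ U i₀, v - u ∈ U i₁ := by
    intro v
    have : v ∈ U i₀ ⊔ U i₁ := hU ▸ Submodule.mem_top
    obtain ⟨u, hu, u', hu', rfl⟩ := Submodule.mem_sup.1 this
    exact ⟨u, hu, by simpa using hu'⟩
  choose s hs0 hs1 using hs
  let g : ℕ → V := fun n => if n < N then s (f n) else 0
  have hg : g ∈ poly (U i₀) := by
    refine ⟨⟨N, fun n hn => if_neg (not_lt.2 hn)⟩, fun n => ?_⟩
    simp only [g]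
    split_ifs
    · exact hs0 _
    · exact zero_mem _
  have hfg : f - g ∈ poly (U i₁) := by
    refine ⟨⟨N, fun n hn => ?_⟩, fun n => ?_⟩
    · simp [g, not_lt.2 hn, hN n hn]
    · by_cases hn : n < N
      · simpa [g, hn] using hs1 (f n)
      · simp [g, hn, hN n (not_lt.1 hn)]
  have := add_mem (divided_le_coded p U i₁ (poly_le_divided _ _ hfg))
    (divided_le_coded p U i₀ (poly_le_divided _ _ hg))
  rwa [sub_add_cancel] at this

/-- Clear denominators: `q w` is finite without constant term, so `q w = X g` with `g` finite, and
`w = X (g - divX q w)`. -/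
theorem exists_shift_eq (hp : CoprimeFamily p) {i₀ i₁ : I} (hU : U i₀ ⊔ U i₁ = ⊤) {w : ℕ → V}
    (hw : w ∈ coded p U) (h0 : w 0 = 0) : ∃ w' ∈ coded p U, shift R V w' = w := by
  obtain ⟨q, hq, ⟨N, hN⟩, -⟩ := coded_le_rational hp hw
  let g : ℕ → V := fun n => act R q w (n + 1)
  have hg : g ∈ poly (⊤ : Submodule R V) := ⟨⟨N, fun n hn => hN _ (by omega)⟩, fun _ => trivial⟩
  have hgs : shift R V g = act R q w := by
    funext n
    cases n with
    | zero => simp [act_eq hq, h0]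
    | succ n => rfl
  refine ⟨g - act R q.divX w, sub_mem (poly_top_le_coded hU hg) (act_mem shift_mem_coded _ hw), ?_⟩
  rw [map_sub, hgs, act_eq hq, add_sub_cancel_right]

theorem single_mem_poly {U : Submodule R V} {v : V} (hv : v ∈ U) :
    (LinearMap.single R (fun _ : ℕ => V) 0 v) ∈ poly U := by
  refine ⟨⟨1, fun n hn => ?_⟩, fun n => ?_⟩
  · simp [Nat.one_le_iff_ne_zero.1 hn]
  · simp only [LinearMap.coe_single, Pi.single_apply]
    split_ifs
    · exact hv
    · exact zero_mem _

/-- The value at `0` of the image of the constant power series `v`. -/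
noncomputable def constantPart {i₀ i₁ : I} (hU : U i₀ ⊔ U i₁ = ⊤)
    (ψ : coded p U →ₗ[R] coded p U') : V →ₗ[R] V' :=
  (LinearMap.proj 0) ∘ₗ (coded p U').subtype ∘ₗ ψ ∘ₗ
    (LinearMap.single R (fun _ : ℕ => V) 0).codRestrict (coded p U)
      fun _ => poly_top_le_coded hU (single_mem_poly trivial)

section ConstantPart

variable {i₀ i₁ : I} (hU : U i₀ ⊔ U i₁ = ⊤) {ψ : coded p U →ₗ[R] coded p U'}
  (hψ : ∀ w w₂ : coded p U, (w₂ : ℕ → V) = shift R V w → (ψ w₂ : ℕ → V') = shift R V' (ψ w))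
include hψ

/-- Removing the constant term of `w` leaves a shift of a coded sequence, whose image is again a
shift and vanishes at `0`. -/
theorem coe_apply_zero (hp : CoprimeFamily p) (w : coded p U) :
    (ψ w : ℕ → V') 0 = constantPart hU ψ ((w : ℕ → V) 0) := by
  let c : coded p U := ⟨LinearMap.single R (fun _ : ℕ => V) 0 ((w : ℕ → V) 0),
    poly_top_le_coded hU (single_mem_poly trivial)⟩
  have hc : constantPart hU ψ ((w : ℕ → V) 0) = (ψ c : ℕ → V') 0 := rfl
  obtain ⟨w', hw', h⟩ := exists_shift_eq hp hU (sub_mem w.2 c.2) (by simp [c])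
  have := hψ ⟨w', hw'⟩ (w - c) h.symm
  rw [hc, ← sub_eq_zero]
  have e := congrFun this 0
  rw [map_sub] at e
  simpa using e

theorem coe_act (q : ℤ[X]) (w w₂ : coded p U) (h : (w₂ : ℕ → V) = act R q w) :
    (ψ w₂ : ℕ → V') = act R q (ψ w) := by
  let sW : Module.End R (coded p U) := (shift R V).restrict shift_mem_coded
  have e1 := aeval_comm ((coded p U').subtype ∘ₗ ψ) sW (shift R V')
    (fun w => hψ w (sW w) rfl) q w
  have e2 := aeval_comm (coded p U).subtype sW (shift R V) (fun _ => rfl) q w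
  have : w₂ = aeval sW q w := Subtype.ext (h.trans e2.symm)
  rw [this]
  exact e1

/-- A constant from `U i` is divisible by every power of `p i` inside the coding module, a property
that `ψ` preserves. -/
theorem constantPart_mem (hp : CoprimeFamily p) {i : I} {v : V} (hv : v ∈ U i) :
    constantPart hU ψ v ∈ U' i := by
  have hc := poly_le_divided (p i) _ (single_mem_poly hv)
  let c : coded p U := ⟨_, divided_le_coded p U i hc⟩
  change (ψ c : ℕ → V') 0 ∈ U' i
  refine mem_of_divisible hp i (ψ c).2 (fun k => ?_) 0
  obtain ⟨g, hg, hgc⟩ := exists_mem_divided_pow (hp.coeff_zero i) hc k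
  exact ⟨_, (ψ ⟨g, divided_le_coded p U i hg⟩).2, (coe_act hψ _ _ c hgc.symm).symm⟩

end ConstantPart

/-- An isomorphism of the coding modules commuting with the shift comes with an isomorphism of the
families of submodules. -/
theorem exists_equiv_of_coded (hp : CoprimeFamily p) {i₀ i₁ : I} (hU : U i₀ ⊔ U i₁ = ⊤)
    (hU' : U' i₀ ⊔ U' i₁ = ⊤) (ψ : coded p U ≃ₗ[R] coded p U')
    (hψ : ∀ w w₂ : coded p U, (w₂ : ℕ → V) = shift R V w → (ψ w₂ : ℕ → V') = shift R V' (ψ w)) :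
    ∃ φ : V ≃ₗ[R] V', ∀ i v, v ∈ U i ↔ φ v ∈ U' i := by
  have hψ' : ∀ w w₂ : coded p U', (w₂ : ℕ → V') = shift R V' w →
      (ψ.symm w₂ : ℕ → V) = shift R V (ψ.symm w) := by
    intro w w₂ h
    have := hψ (ψ.symm w) ⟨_, shift_mem_coded _ (ψ.symm w).2⟩ rfl
    rw [ψ.apply_symm_apply, ← h] at this
    rw [← Subtype.ext this, ψ.symm_apply_apply]
  have h1 : ∀ v, constantPart hU' ψ.symm.toLinearMap (constantPart hU ψ.toLinearMap v) = v := by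
    intro v
    refine (coe_apply_zero hU' (ψ := ψ.symm.toLinearMap) hψ' hp _).symm.trans ?_
    rw [LinearMap.comp_apply, LinearEquiv.coe_coe, LinearEquiv.coe_coe, ψ.symm_apply_apply]
    simp
  have h2 : ∀ v, constantPart hU ψ.toLinearMap (constantPart hU' ψ.symm.toLinearMap v) = v := by
    intro v
    refine (coe_apply_zero hU (ψ := ψ.toLinearMap) hψ hp _).symm.trans ?_
    rw [LinearMap.comp_apply, LinearEquiv.coe_coe, LinearEquiv.coe_coe, ψ.apply_symm_apply]
    simp
  refine ⟨LinearEquiv.ofLinearMap (constantPart hU ψ.toLinearMap)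
    (constantPart hU' ψ.symm.toLinearMap) (LinearMap.ext h2) (LinearMap.ext h1), fun i v =>
    ⟨fun hv => constantPart_mem hU (ψ := ψ.toLinearMap) hψ hp hv, fun hv => ?_⟩⟩
  rw [← h1 v]
  exact constantPart_mem hU' (ψ := ψ.symm.toLinearMap) hψ' hp hv

end Coded

/-! #### Linear maps acting coefficientwise -/

section CompLeft

variable (φ : V →ₗ[R] V')

theorem compLeft_shift (f : ℕ → V) : φ.compLeft ℕ (shift R V f) = shift R V' (φ.compLeft ℕ f) := by
  funext n
  cases n <;> simp

theorem compLeft_act (q : ℤ[X]) (f : ℕ → V) :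
    φ.compLeft ℕ (act R q f) = act R q (φ.compLeft ℕ f) :=
  aeval_comm _ _ _ (compLeft_shift φ) q f

theorem compLeft_mem_poly {U : Submodule R V} {U' : Submodule R V'} (h : ∀ v ∈ U, φ v ∈ U')
    {f : ℕ → V} (hf : f ∈ poly U) : φ.compLeft ℕ f ∈ poly U' := by
  obtain ⟨⟨N, hN⟩, hU⟩ := hf
  exact ⟨⟨N, fun n hn => by simp [hN n hn]⟩, fun n => h _ (hU n)⟩

theorem compLeft_mem_rational {f : ℕ → V} (hf : f ∈ rational R V) :
    φ.compLeft ℕ f ∈ rational R V' := by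
  obtain ⟨q, hq, h⟩ := hf
  exact ⟨q, hq, by rw [← compLeft_act]; exact compLeft_mem_poly φ (fun _ _ => Submodule.mem_top) h⟩

theorem compLeft_mem_coded {p : I → ℤ[X]} {U : I → Submodule R V} {U' : I → Submodule R V'}
    (h : ∀ i, ∀ v ∈ U i, φ v ∈ U' i) {f : ℕ → V} (hf : f ∈ coded p U) :
    φ.compLeft ℕ f ∈ coded p U' := by
  refine Submodule.iSup_induction (motive := fun f => φ.compLeft ℕ f ∈ coded p U') _ hf ?_ ?_ ?_
  · rintro i f ⟨k, hk⟩
    exact divided_le_coded p U' i ⟨k, by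
      rw [← compLeft_act]
      exact compLeft_mem_poly φ (h i) hk⟩
  · rw [map_zero]
    exact zero_mem _
  · intro f g hf hg
    rw [map_add]
    exact add_mem hf hg

end CompLeft

end SeqModule

/-! ### Pairs of modules -/

section Pairs

variable {R A A' : Type*} [Ring R] [AddCommMonoid A] [Module R A] [AddCommMonoid A'] [Module R A']

/-- The graph of the restriction of a linear map to a submodule. -/
def Submodule.graphOn (N : Submodule R A) (θ : A →ₗ[R] A) : Submodule R (A × A) where
  carrier := {x | x.1 ∈ N ∧ x.2 = θ x.1}
  add_mem' := by
    rintro x y ⟨hx, hx'⟩ ⟨hy, hy'⟩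
    exact ⟨N.add_mem hx hy, by simp [hx', hy']⟩
  zero_mem' := ⟨N.zero_mem, by simp⟩
  smul_mem' := by
    rintro r x ⟨hx, hx'⟩
    exact ⟨N.smul_mem r hx, by simp [hx']⟩

theorem Submodule.mem_graphOn {N : Submodule R A} {θ : A →ₗ[R] A} {x : A × A} :
    x ∈ N.graphOn θ ↔ x.1 ∈ N ∧ x.2 = θ x.1 := Iff.rfl

/-- The four submodules of `A × A` recording a submodule `N` and an endomorphism `θ`. -/
def pairSubmodules (N : Submodule R A) (θ : A →ₗ[R] A) : Fin 4 → Submodule R (A × A) :=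
  ![N.graphOn 0, (⊥ : Submodule R A).prod N, N.graphOn LinearMap.id, N.graphOn θ]

/-- The two axes are preserved, and preserving the diagonal forces the same action on both. -/
theorem pair_apply {N : Submodule R A} {N' : Submodule R A'} (Ψ : (A × A) →ₗ[R] (A' × A'))
    (h0 : ∀ x ∈ N.graphOn 0, Ψ x ∈ N'.graphOn 0)
    (h1 : ∀ x ∈ (⊥ : Submodule R A).prod N, Ψ x ∈ (⊥ : Submodule R A').prod N')
    (h2 : ∀ x ∈ N.graphOn LinearMap.id, Ψ x ∈ N'.graphOn LinearMap.id) {w w' : A} (hw : w ∈ N)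
    (hw' : w' ∈ N) : Ψ (w, w') = ((Ψ (w, 0)).1, (Ψ (w', 0)).1) := by
  have e1 : Ψ (w, w') = Ψ (w, 0) + Ψ (0, w') := by rw [← map_add]; simp
  have e2 : Ψ (w', w') = Ψ (w', 0) + Ψ (0, w') := by rw [← map_add]; simp
  obtain ⟨-, a2⟩ := h0 (w, 0) ⟨hw, rfl⟩
  obtain ⟨-, b2⟩ := h0 (w', 0) ⟨hw', rfl⟩
  obtain ⟨c1, -⟩ := h1 (0, w') ⟨rfl, hw'⟩
  obtain ⟨-, d2⟩ := h2 (w', w') ⟨hw', rfl⟩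
  have c1' : (Ψ (0, w')).1 = 0 := c1
  rw [e2] at d2
  refine Prod.ext ?_ ?_
  · rw [e1]
    simp [c1']
  · rw [e1]
    simp only [LinearMap.zero_apply, LinearMap.id_apply, Prod.snd_add, Prod.fst_add] at *
    rw [b2, c1', zero_add, add_zero] at d2
    rw [a2, zero_add]
    exact d2

theorem exists_equiv_of_pair {N : Submodule R A} {N' : Submodule R A'}
    (Ψ : (A × A) ≃ₗ[R] (A' × A')) (h0 : ∀ x, x ∈ N.graphOn 0 ↔ Ψ x ∈ N'.graphOn 0)
    (h1 : ∀ x, x ∈ (⊥ : Submodule R A).prod N ↔ Ψ x ∈ (⊥ : Submodule R A').prod N')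
    (h2 : ∀ x, x ∈ N.graphOn LinearMap.id ↔ Ψ x ∈ N'.graphOn LinearMap.id) :
    ∃ e : N ≃ₗ[R] N', ∀ w w' : N, Ψ (w, w') = (↑(e w), ↑(e w')) := by
  have k0 : ∀ x ∈ N'.graphOn 0, Ψ.symm x ∈ N.graphOn 0 := fun x hx => by
    rwa [h0, Ψ.apply_symm_apply]
  have hmap : ∀ w ∈ N, ((LinearMap.fst R A' A') ∘ₗ Ψ.toLinearMap ∘ₗ LinearMap.inl R A A) w ∈ N' :=
    fun w hw => ((h0 (w, 0)).1 ⟨hw, rfl⟩).1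
  have hmap' : ∀ w ∈ N', ((LinearMap.fst R A A) ∘ₗ Ψ.symm.toLinearMap ∘ₗ
      LinearMap.inl R A' A') w ∈ N := fun w hw => (k0 (w, 0) ⟨hw, rfl⟩).1
  have e1 : ∀ w : N, Ψ.symm ((Ψ ((w : A), (0 : A))).1, 0) = ((w : A), (0 : A)) := by
    intro w
    have : ((Ψ ((w : A), (0 : A))).1, (0 : A')) = Ψ ((w : A), (0 : A)) :=
      Prod.ext rfl ((h0 (w, 0)).1 ⟨w.2, rfl⟩).2.symm
    rw [this, Ψ.symm_apply_apply]
  have e2 : ∀ w : N', Ψ ((Ψ.symm ((w : A'), (0 : A'))).1, 0) = ((w : A'), (0 : A')) := by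
    intro w
    have : ((Ψ.symm ((w : A'), (0 : A'))).1, (0 : A)) = Ψ.symm ((w : A'), (0 : A')) :=
      Prod.ext rfl (k0 (w, 0) ⟨w.2, rfl⟩).2.symm
    rw [this, Ψ.apply_symm_apply]
  refine ⟨LinearEquiv.ofLinearMap (LinearMap.restrict _ hmap) (LinearMap.restrict _ hmap') ?_ ?_,
    fun w w' => ?_⟩
  · refine LinearMap.ext fun w => Subtype.ext ?_
    exact congrArg Prod.fst (e2 w)
  · refine LinearMap.ext fun w => Subtype.ext ?_
    exact congrArg Prod.fst (e1 w)
  · exact pair_apply Ψ.toLinearMap (fun x => (h0 x).1) (fun x => (h1 x).1) (fun x => (h2 x).1)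
      w.2 w'.2

/-- Isomorphisms matching `N`, `N'` and intertwining endomorphisms match the graphs. -/
theorem mem_graphOn_prodCongr {N : Submodule R A} {N' : Submodule R A'} {θ : A →ₗ[R] A}
    {θ' : A' →ₗ[R] A'} (φ : A ≃ₗ[R] A') (hN : ∀ v, v ∈ N ↔ φ v ∈ N')
    (hθ : ∀ v, φ (θ v) = θ' (φ v)) (x : A × A) :
    x ∈ N.graphOn θ ↔ φ.prodCongr φ x ∈ N'.graphOn θ' := by
  rw [Submodule.mem_graphOn, Submodule.mem_graphOn, LinearEquiv.prodCongr_apply, ← hθ, hN,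
    φ.injective.eq_iff]

theorem mem_bot_prod_prodCongr {N : Submodule R A} {N' : Submodule R A'} (φ : A ≃ₗ[R] A')
    (hN : ∀ v, v ∈ N ↔ φ v ∈ N') (x : A × A) :
    x ∈ (⊥ : Submodule R A).prod N ↔ φ.prodCongr φ x ∈ (⊥ : Submodule R A').prod N' := by
  rw [Submodule.mem_prod, Submodule.mem_prod, LinearEquiv.prodCongr_apply, hN]
  simp

end Pairs

/-! ### Coding a set of words by four submodules -/

namespace WordModule

open SeqModule LabelledWord

variable (R J : Type*) [Ring R]

/-- The square of `WordModule`. -/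
abbrev Square : Type _ := WordModule R J × WordModule R J

variable {R J}

/-- The submodules of the square of `WordModule` recording `ofSet S` and the distinguished
endomorphisms. -/
noncomputable def squareSubmodules (S : Set (LabelledWord J)) :
    Fin 4 ⊕ WordEndo R J → Submodule R (Square R J) :=
  Sum.elim ![(⊤ : Submodule R (WordModule R J)).graphOn 0,
      (⊥ : Submodule R (WordModule R J)).prod ⊤,
      (⊤ : Submodule R (WordModule R J)).graphOn LinearMap.id, (ofSet S).graphOn 0]
    fun θ => (⊤ : Submodule R (WordModule R J)).graphOn (endo θ)

/-- The two axes supply the pair of members with sum `⊤` that the coding of families requires. -/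
theorem squareSubmodules_sup (S : Set (LabelledWord J)) :
    squareSubmodules (R := R) S (Sum.inl 0) ⊔ squareSubmodules S (Sum.inl 1) = ⊤ := by
  rw [eq_top_iff]
  rintro ⟨v, w⟩ -
  have : ((v, w) : Square R J) = (v, 0) + (0, w) := by simp
  rw [this]
  exact Submodule.add_mem_sup (show _ ∈ Submodule.graphOn _ _ from ⟨trivial, rfl⟩)
    (show _ ∈ Submodule.prod _ _ from ⟨rfl, trivial⟩)

/-- Axes and diagonal make `Φ` of the form `φ × φ`; preserving the graph of `endo θ` then means
commuting with it, and the member of index `inl 3` carries the set. -/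
theorem exists_perm_of_square [Nontrivial R] [Nonempty J] {S S' : Set (LabelledWord J)}
    (Φ : Square R J ≃ₗ[R] Square R J)
    (h : ∀ i v, v ∈ squareSubmodules S i ↔ Φ v ∈ squareSubmodules S' i) :
    ∃ σ : Equiv.Perm ℕ, ∀ o, o ∈ S ↔ move σ o ∈ S' := by
  obtain ⟨e, he⟩ := exists_equiv_of_pair Φ (h (Sum.inl 0)) (h (Sum.inl 1)) (h (Sum.inl 2))
  let φ : WordModule R J ≃ₗ[R] WordModule R J :=
    Submodule.topEquiv.symm ≪≫ₗ e ≪≫ₗ Submodule.topEquiv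
  have hφ : ∀ v w, Φ (v, w) = (φ v, φ w) := fun v w => he ⟨v, trivial⟩ ⟨w, trivial⟩
  refine exists_perm_of_equiv φ (fun θ v => ?_) fun v => ?_
  · have := (h (Sum.inr θ) (v, endo θ v)).1 ⟨trivial, rfl⟩
    rw [hφ] at this
    exact this.2
  · have := h (Sum.inl 3) (v, 0)
    rw [hφ, map_zero] at this
    exact ⟨fun hv => (this.1 ⟨hv, rfl⟩).1, fun hv => (this.2 ⟨hv, rfl⟩).1⟩

theorem exists_square_of_perm {S S' : Set (LabelledWord J)} (σ : Equiv.Perm ℕ)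
    (hσ : ∀ o, o ∈ S ↔ move σ o ∈ S') : ∃ Φ : Square R J ≃ₗ[R] Square R J,
      ∀ i v, v ∈ squareSubmodules S i ↔ Φ v ∈ squareSubmodules S' i := by
  obtain ⟨φ, hφ, hS⟩ := exists_equiv_of_perm R σ hσ
  have htop : ∀ v, v ∈ (⊤ : Submodule R (WordModule R J)) ↔ φ v ∈
    (⊤ : Submodule R (WordModule R J)) := fun v => by simp
  refine ⟨φ.prodCongr φ, ?_⟩
  rintro (i | θ)
  · fin_cases i
    · exact mem_graphOn_prodCongr φ htop (by simp)
    · exact mem_bot_prod_prodCongr φ htop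
    · exact mem_graphOn_prodCongr φ htop (by simp)
    · exact mem_graphOn_prodCongr φ hS (by simp)
  · exact mem_graphOn_prodCongr φ htop (hφ θ)

variable (p : Fin 4 ⊕ WordEndo R J → Polynomial ℤ)

/-- The square of the module of rational power series over `Square R J`. -/
abbrev CodeModule (R J : Type*) [Ring R] : Type _ :=
  rational R (Square R J) × rational R (Square R J)

/-- The submodule of rational power series coding `S`. -/
noncomputable def codeBase (S : Set (LabelledWord J)) : Submodule R (rational R (Square R J)) :=
  (coded p (squareSubmodules S)).submoduleOf (rational R (Square R J))

theorem mem_codeBase {S : Set (LabelledWord J)} {w : rational R (Square R J)} :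
    w ∈ codeBase p S ↔ (w : ℕ → Square R J) ∈ coded p (squareSubmodules S) := Iff.rfl

/-- The shift of rational power series. -/
noncomputable def codeShift (R J : Type*) [Ring R] :
    rational R (Square R J) →ₗ[R] rational R (Square R J) :=
  (shift R (Square R J)).restrict shift_mem_rational

/-- The four submodules coding `S`. -/
noncomputable def codeSubmodules (S : Set (LabelledWord J)) :
    Fin 4 → Submodule R (CodeModule R J) :=
  pairSubmodules (codeBase p S) (codeShift R J)

variable {p}

theorem exists_perm_of_code [Nontrivial R] [Nonempty J] (hp : CoprimeFamily p)
    {S S' : Set (LabelledWord J)} (Ψ : CodeModule R J ≃ₗ[R] CodeModule R J)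
    (h : ∀ i v, v ∈ codeSubmodules p S i ↔ Ψ v ∈ codeSubmodules p S' i) :
    ∃ σ : Equiv.Perm ℕ, ∀ o, o ∈ S ↔ move σ o ∈ S' := by
  obtain ⟨e, he⟩ := exists_equiv_of_pair Ψ (h 0) (h 1) (h 2)
  let c : ∀ S : Set (LabelledWord J), codeBase p S ≃ₗ[R] coded p (squareSubmodules S) :=
    fun S => Submodule.submoduleOfEquivOfLe (coded_le_rational hp)
  obtain ⟨Φ, hΦ⟩ := exists_equiv_of_coded hp (squareSubmodules_sup S) (squareSubmodules_sup S')
    ((c S).symm ≪≫ₗ e ≪≫ₗ c S') (fun w w₂ hw => by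
      have h1 : ((((c S).symm w : codeBase p S) : rational R (Square R J)),
          (((c S).symm w₂ : codeBase p S) : rational R (Square R J))) ∈
          (codeBase p S).graphOn (codeShift R J) :=
        ⟨((c S).symm w).2, Subtype.ext hw⟩
      have h2 := (h 3 _).1 h1
      rw [he] at h2
      exact congrArg Subtype.val h2.2)
  exact exists_perm_of_square Φ hΦ

/-- The automorphism of the square acts coefficientwise on power series, which commutes with the
shift and so with all polynomials. -/
theorem exists_code_of_perm {S S' : Set (LabelledWord J)} (σ : Equiv.Perm ℕ)
    (hσ : ∀ o, o ∈ S ↔ move σ o ∈ S') : ∃ Ψ : CodeModule R J ≃ₗ[R] CodeModule R J,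
      ∀ i v, v ∈ codeSubmodules p S i ↔ Ψ v ∈ codeSubmodules p S' i := by
  obtain ⟨Φ, hΦ⟩ := exists_square_of_perm (R := R) σ hσ
  let f : rational R (Square R J) →ₗ[R] rational R (Square R J) :=
    (Φ.toLinearMap.compLeft ℕ).restrict fun _ => compLeft_mem_rational _
  let g : rational R (Square R J) →ₗ[R] rational R (Square R J) :=
    (Φ.symm.toLinearMap.compLeft ℕ).restrict fun _ => compLeft_mem_rational _
  let φ : rational R (Square R J) ≃ₗ[R] rational R (Square R J) := LinearEquiv.ofLinearMap f g
    (by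
      refine LinearMap.ext fun w => Subtype.ext (funext fun n => ?_)
      exact Φ.apply_symm_apply _)
    (by
      refine LinearMap.ext fun w => Subtype.ext (funext fun n => ?_)
      exact Φ.symm_apply_apply _)
  have hbase : ∀ v, v ∈ codeBase p S ↔ φ v ∈ codeBase p S' := by
    intro v
    refine ⟨fun hv => compLeft_mem_coded Φ.toLinearMap (fun i w => (hΦ i w).1) hv, fun hv => ?_⟩
    have : v = φ.symm (φ v) := (φ.symm_apply_apply v).symm
    rw [this]
    exact compLeft_mem_coded Φ.symm.toLinearMap (fun i w hw => by
      rw [hΦ]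
      simpa using hw) hv
  refine ⟨φ.prodCongr φ, fun i => ?_⟩
  fin_cases i
  · exact mem_graphOn_prodCongr φ hbase (by simp)
  · exact mem_bot_prod_prodCongr φ hbase
  · exact mem_graphOn_prodCongr φ hbase (by simp)
  · exact mem_graphOn_prodCongr φ hbase fun v => Subtype.ext (compLeft_shift _ _)

instance [Nontrivial R] : Infinite (CodeModule R J) := by
  refine Infinite.of_injective (β := ℕ) (fun n =>
    ((⟨LinearMap.single R (fun _ : ℕ => Square R J) 0 (Finsupp.single (.grp n 1) 1, 0),
      1, by simp, by simpa using single_mem_poly Submodule.mem_top⟩ : rational R (Square R J)), 0))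
    fun m n h => ?_
  have h1 := congrFun (congrArg Subtype.val (congrArg Prod.fst h)) 0
  have h2 := congrArg Prod.fst h1
  simp only [LinearMap.coe_single, Pi.single_eq_same] at h2
  have h3 := Finsupp.single_left_injective (one_ne_zero (α := R)) h2
  injection h3

end WordModule

/-! ### Structures from modules with four submodules -/

namespace BorelModels

open FirstOrder Language

theorem InfFormula.realize_ofFirstOrder {L : Language} {M : Type*} [L.Structure M] {n : ℕ}
    (φ : L.BoundedFormula Empty n) (x : Fin n → M) :
    (InfFormula.ofFirstOrder φ).Realize x ↔ φ.Realize Empty.elim x := by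
  induction φ with
  | falsum => rfl
  | equal => rfl
  | rel => rfl
  | imp φ ψ hφ hψ =>
    simp only [InfFormula.ofFirstOrder, InfFormula.Realize, BoundedFormula.realize_imp, hφ, hψ]
  | all φ hφ =>
    simp only [InfFormula.ofFirstOrder, InfFormula.Realize, BoundedFormula.realize_all, hφ]

section OfModule

variable {R : Type*} [Ring R] {M : Type*} [AddCommGroup M] [Module R M] (e : ℕ ≃ M)
  (X : Fin 4 → Submodule R M)

/-- The structure with universe `ℕ` obtained by transport from a module with four submodules. -/
def strOfModule : Str (langFour R) where
  str :=
    { funMap := fun f a => match f, a with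
        | .plus, a => e.symm (e (a 0) + e (a 1))
        | .zero, _ => e.symm 0
        | .scal r, a => e.symm (r • e (a 0))
      RelMap := fun r a => match r, a with
        | .mem i, a => e (a 0) ∈ X i }

theorem strOfModule_mem_mod :
    strOfModule e X ∈ Mod (InfFormula.ofFirstOrder '' fourSubmodulesTheory R) := by
  rintro _ ⟨φ, hφ, rfl⟩
  let _ : (langFour R).Structure ℕ := (strOfModule e X).str
  change InfFormula.Realize (M := ℕ) _ _
  have hplus : ∀ {n : ℕ} (v : Empty ⊕ Fin n → ℕ) (s t : (langFour R).Term (Empty ⊕ Fin n)),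
    (tPlus s t).realize v = e.symm (e (s.realize v) + e (t.realize v)) := fun _ _ _ => rfl
  have hzero : ∀ {n : ℕ} (v : Empty ⊕ Fin n → ℕ),
    (tZero : (langFour R).Term (Empty ⊕ Fin n)).realize v = e.symm 0 := fun _ => rfl
  have hscal : ∀ {n : ℕ} (v : Empty ⊕ Fin n → ℕ) (r : R) (t : (langFour R).Term (Empty ⊕ Fin n)),
    (tScal r t).realize v = e.symm (r • e (t.realize v)) := fun _ _ _ => rfl
  have hvar : ∀ {n : ℕ} (v : Empty ⊕ Fin n → ℕ) (i : Fin n),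
    (tVar i : (langFour R).Term (Empty ⊕ Fin n)).realize v = v (Sum.inr i) := fun _ _ => rfl
  have hmem : ∀ {n : ℕ} (v : Empty → ℕ) (x : Fin n → ℕ) (i : Fin 4)
    (t : (langFour R).Term (Empty ⊕ Fin n)),
    (fMem i t).Realize v x ↔ e (t.realize (Sum.elim v x)) ∈ X i := fun _ _ _ _ => Iff.rfl
  rw [InfFormula.realize_ofFirstOrder]
  rcases hφ with hφ | hφ
  · cases hφ with
    | exists_neg =>
      refine BoundedFormula.realize_alls.2 fun x => ?_
      rw [BoundedFormula.realize_ex]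
      refine ⟨e.symm (-e (x 0)), ?_⟩
      simp [hplus, hzero, hvar, Fin.snoc]
    | plus_assoc =>
      refine BoundedFormula.realize_alls.2 fun x => ?_
      simp [hplus, hvar, add_assoc]
    | plus_comm =>
      refine BoundedFormula.realize_alls.2 fun x => ?_
      simp [hplus, hvar, add_comm]
    | plus_zero =>
      refine BoundedFormula.realize_alls.2 fun x => ?_
      simp [hplus, hvar, hzero]
    | scal_plus r =>
      refine BoundedFormula.realize_alls.2 fun x => ?_
      simp [hplus, hvar, hscal]
    | plus_scal r s =>
      refine BoundedFormula.realize_alls.2 fun x => ?_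
      simp [hplus, hvar, hscal, add_smul]
    | mul_scal r s =>
      refine BoundedFormula.realize_alls.2 fun x => ?_
      simp [hvar, hscal, mul_smul]
    | one_scal =>
      refine BoundedFormula.realize_alls.2 fun x => ?_
      simp [hvar, hscal]
  · cases hφ with
    | zero_mem i =>
      rw [hmem, hzero, e.apply_symm_apply]
      exact (X i).zero_mem
    | plus_mem i =>
      refine BoundedFormula.realize_alls.2 fun x => ?_
      simp only [BoundedFormula.realize_imp, hmem, hplus, Equiv.apply_symm_apply]
      exact fun h0 h1 => (X i).add_mem h0 h1
    | scal_mem i r =>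
      refine BoundedFormula.realize_alls.2 fun x => ?_
      simp only [BoundedFormula.realize_imp, hmem, hscal, Equiv.apply_symm_apply]
      exact fun h0 => (X i).smul_mem r h0

theorem strOfModule_iso_iff (X X' : Fin 4 → Submodule R M) :
    Str.Iso (strOfModule e X) (strOfModule e X') ↔
      ∃ Ψ : M ≃ₗ[R] M, ∀ i v, v ∈ X i ↔ Ψ v ∈ X' i := by
  constructor
  · rintro ⟨Φ⟩
    let f : ℕ ≃ ℕ := @Language.Equiv.toEquiv (langFour R) ℕ ℕ (strOfModule e X).str
      (strOfModule e X').str Φ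
    have hfun : ∀ {n : ℕ} (t : (langFour R).Functions n) a,
        f ((strOfModule e X).str.funMap t a) = (strOfModule e X').str.funMap t (f ∘ a) :=
      fun t a => @Language.Equiv.map_fun' (langFour R) ℕ ℕ (strOfModule e X).str
        (strOfModule e X').str Φ _ t a
    have hrel : ∀ {n : ℕ} (t : (langFour R).Relations n) a,
        (strOfModule e X').str.RelMap t (f ∘ a) ↔ (strOfModule e X).str.RelMap t a :=
      fun t a => @Language.Equiv.map_rel' (langFour R) ℕ ℕ (strOfModule e X).str
        (strOfModule e X').str Φ _ t a
    have hplus : ∀ a b, f (e.symm (a + b)) = e.symm (e (f (e.symm a)) + e (f (e.symm b))) := by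
      intro a b
      have := hfun ModFunctions.plus ![e.symm a, e.symm b]
      change f (e.symm (e (e.symm a) + e (e.symm b))) =
        e.symm (e (f (e.symm a)) + e (f (e.symm b))) at this
      rwa [e.apply_symm_apply, e.apply_symm_apply] at this
    have hscal : ∀ (r : R) a, f (e.symm (r • a)) = e.symm (r • e (f (e.symm a))) := by
      intro r a
      have := hfun (ModFunctions.scal r) ![e.symm a]
      change f (e.symm (r • e (e.symm a))) = e.symm (r • e (f (e.symm a))) at this
      rwa [e.apply_symm_apply] at this
    refine ⟨{ (e.symm.trans f).trans e with
      map_add' := fun a b => ?_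
      map_smul' := fun r a => ?_ }, fun i v => ?_⟩
    · exact (congrArg e (hplus a b)).trans (e.apply_symm_apply _)
    · exact (congrArg e (hscal r a)).trans (e.apply_symm_apply _)
    · have := hrel (SubmodRelations.mem i) ![e.symm v]
      change e (f (e.symm v)) ∈ X' i ↔ e (e.symm v) ∈ X i at this
      rw [e.apply_symm_apply] at this
      exact this.symm
  · rintro ⟨Ψ, hΨ⟩
    refine ⟨@Language.Equiv.mk (langFour R) ℕ ℕ (strOfModule e X).str (strOfModule e X').str
      ((e.trans Ψ.toEquiv).trans e.symm) ?_ ?_⟩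
    · rintro n (_ | _ | r) a
      · change e.symm (Ψ (e (e.symm (e (a 0) + e (a 1))))) =
          e.symm (e (e.symm (Ψ (e (a 0)))) + e (e.symm (Ψ (e (a 1)))))
        simp
      · change e.symm (Ψ (e (e.symm 0))) = e.symm 0
        simp
      · change e.symm (Ψ (e (e.symm (r • e (a 0))))) = e.symm (r • e (e.symm (Ψ (e (a 0)))))
        simp
    · rintro n ⟨i⟩ a
      change e (e.symm (Ψ (e (a 0)))) ∈ X' i ↔ e (a 0) ∈ X i
      rw [e.apply_symm_apply, hΨ]

end OfModule

end BorelModels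

/-! ### Measurability -/

namespace WordModule

open SeqModule LabelledWord

variable {R J X : Type*} [Ring R] [MeasurableSpace X] {S : X → Set (LabelledWord J)}

theorem measurable_mem_ofSet [Countable J] (hS : ∀ o, Measurable fun x => o ∈ S x)
    (h : WordModule R J) : Measurable fun x => h ∈ ofSet (S x) := by
  have : (fun x => h ∈ ofSet (S x)) = fun x => ∀ o, o ∈ S x ∨ h (.cst o) = 0 := by
    funext x
    refine propext (forall_congr' fun o => ?_)
    tauto
  rw [this]
  exact Measurable.forall fun o => (hS o).or measurable_const

theorem squareSubmodules_three (S : Set (LabelledWord J)) :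
    squareSubmodules (R := R) S (Sum.inl 3) = (ofSet S).graphOn 0 := rfl

theorem squareSubmodules_zero (S : Set (LabelledWord J)) : squareSubmodules (R := R) S (Sum.inl 0) =
    (⊤ : Submodule R (WordModule R J)).graphOn 0 := rfl

theorem squareSubmodules_one (S : Set (LabelledWord J)) : squareSubmodules (R := R) S (Sum.inl 1) =
    (⊥ : Submodule R (WordModule R J)).prod ⊤ := rfl

theorem squareSubmodules_two (S : Set (LabelledWord J)) : squareSubmodules (R := R) S (Sum.inl 2) =
    (⊤ : Submodule R (WordModule R J)).graphOn LinearMap.id := rfl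

theorem squareSubmodules_inr (S : Set (LabelledWord J)) (θ : WordEndo R J) :
    squareSubmodules S (Sum.inr θ) = (⊤ : Submodule R (WordModule R J)).graphOn (endo θ) := rfl

theorem squareSubmodules_eq_of_ne (S S' : Set (LabelledWord J)) {i : Fin 4 ⊕ WordEndo R J}
    (hi : i ≠ Sum.inl 3) : squareSubmodules S i = squareSubmodules S' i := by
  rcases i with i | θ
  · match i with
    | 0 => rw [squareSubmodules_zero, squareSubmodules_zero]
    | 1 => rw [squareSubmodules_one, squareSubmodules_one]
    | 2 => rw [squareSubmodules_two, squareSubmodules_two]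
    | 3 => exact absurd rfl hi
  · rw [squareSubmodules_inr, squareSubmodules_inr]

/-- Only the member of index `inl 3` depends on `S`. Splitting it off makes membership an
existential over a countable module, with a second condition free of `S`. -/
theorem mem_coded_squareSubmodules (p : Fin 4 ⊕ WordEndo R J → Polynomial ℤ)
    (hp : CoprimeFamily p) (S : Set (LabelledWord J)) (w : rational R (Square R J)) :
    (w : ℕ → Square R J) ∈ coded p (squareSubmodules S) ↔
      ∃ d : rational R (Square R J),
        (d : ℕ → Square R J) ∈ divided (p (Sum.inl 3)) ((ofSet S).graphOn 0) ∧
        (w - d : ℕ → Square R J) ∈ ⨆ (i) (_ : i ≠ Sum.inl 3), divided (p i) (squareSubmodules ∅ i) := by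
  have h : coded p (squareSubmodules S) = divided (p (Sum.inl 3)) ((ofSet S).graphOn 0) ⊔
      ⨆ (i) (_ : i ≠ Sum.inl 3), divided (p i) (squareSubmodules ∅ i) := by
    rw [coded, iSup_split_single _ (Sum.inl 3), squareSubmodules_three]
    exact congrArg _ (iSup_congr fun i => iSup_congr fun hi => by
      rw [squareSubmodules_eq_of_ne S ∅ hi])
  rw [h, Submodule.mem_sup]
  constructor
  · rintro ⟨d, hd, y, hy, hdy⟩
    refine ⟨⟨d, divided_le_rational (hp.coeff_zero _) _ hd⟩, hd, ?_⟩
    rw [← hdy, add_sub_cancel_left]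
    exact hy
  · rintro ⟨d, hd, hy⟩
    exact ⟨d, hd, _, hy, add_sub_cancel _ _⟩

theorem measurable_mem_codeSubmodules [Countable R] [Countable J]
    (p : Fin 4 ⊕ WordEndo R J → Polynomial ℤ) (hp : CoprimeFamily p)
    (hS : ∀ o, Measurable fun x => o ∈ S x) (i : Fin 4) (v : CodeModule R J) :
    Measurable fun x => v ∈ codeSubmodules p (S x) i := by
  have hbase : ∀ w : rational R (Square R J), Measurable fun x => w ∈ codeBase p (S x) := by
    intro w
    -- All quantifiers that appear range over countable types.
    simp only [mem_codeBase, mem_coded_squareSubmodules p hp, mem_divided, mem_poly,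
      Submodule.mem_graphOn]
    exact Measurable.exists fun d => (Measurable.exists fun k => measurable_const.and
      (Measurable.forall fun n => (measurable_mem_ofSet hS _).and measurable_const)).and
      measurable_const
  fin_cases i
  · exact (hbase v.1).and measurable_const
  · exact Measurable.and (measurable_const (a := v.1 ∈ (⊥ : Submodule R _))) (hbase v.2)
  · exact (hbase v.1).and measurable_const
  · exact (hbase v.1).and measurable_const

end WordModule

namespace BorelModels

open FirstOrder Language WordModule LabelledWord SeqModule

namespace Str

/-- In a countable language the defining subbasis is countable, so it generates the Borel sets. -/
theorem measurable_of_eval {L : Language} [Countable L.Symbols] {X : Type*} [MeasurableSpace X]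
    {F : X → Str L}
    (hfun : ∀ (n : ℕ) (f : L.Functions n) a b, Measurable fun x => (F x).evalFun f a = b)
    (hrel : ∀ (n : ℕ) (r : L.Relations n) a, Measurable fun x => (F x).evalRel r a) :
    Measurable F := by
  have hcf : Countable (Σ n, L.Functions n) :=
    (Sum.inl_injective (β := Σ n, L.Relations n)).countable (α := Σ n, L.Functions n)
      (β := L.Symbols)
  have hcr : Countable (Σ n, L.Relations n) :=
    (Sum.inr_injective (α := Σ n, L.Functions n)).countable (α := Σ n, L.Relations n)
      (β := L.Symbols)
  let s : Set (Set (Str L)) :=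
    ({s | ∃ (n : ℕ) (f : L.Functions n) (a : Fin n → ℕ) (b : ℕ), s = {M | M.evalFun f a = b}} ∪
     {s | ∃ (n : ℕ) (r : L.Relations n) (a : Fin n → ℕ), s = {M | M.evalRel r a}} ∪
     {s | ∃ (n : ℕ) (r : L.Relations n) (a : Fin n → ℕ), s = {M | ¬ M.evalRel r a}})
  have hs : s.Countable := by
    refine (Set.Countable.union ?_ ?_).union ?_
    · refine (Set.countable_range fun t : (Σ f : (Σ n, L.Functions n), (Fin f.1 → ℕ) × ℕ) =>
        {M : Str L | M.evalFun t.1.2 t.2.1 = t.2.2}).mono ?_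
      rintro _ ⟨n, f, a, b, rfl⟩
      exact ⟨⟨⟨n, f⟩, a, b⟩, rfl⟩
    · refine (Set.countable_range fun t : (Σ r : (Σ n, L.Relations n), (Fin r.1 → ℕ)) =>
        {M : Str L | M.evalRel t.1.2 t.2}).mono ?_
      rintro _ ⟨n, r, a, rfl⟩
      exact ⟨⟨⟨n, r⟩, a⟩, rfl⟩
    · refine (Set.countable_range fun t : (Σ r : (Σ n, L.Relations n), (Fin r.1 → ℕ)) =>
        {M : Str L | ¬ M.evalRel t.1.2 t.2}).mono ?_
      rintro _ ⟨n, r, a, rfl⟩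
      exact ⟨⟨⟨n, r⟩, a⟩, rfl⟩
  have : SecondCountableTopology (Str L) := ⟨⟨s, hs, rfl⟩⟩
  change @Measurable X (Str L) _ (borel (Str L)) F
  rw [borel_eq_generateFrom_of_subbasis (s := s) rfl]
  refine measurable_generateFrom ?_
  rintro _ ((⟨n, f, a, b, rfl⟩ | ⟨n, r, a, rfl⟩) | ⟨n, r, a, rfl⟩)
  · exact measurableSet_setOfPred.2 (hfun n f a b)
  · exact measurableSet_setOfPred.2 (hrel n r a)
  · exact measurableSet_setOfPred.2 (hrel n r a).not

variable {L : Language}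

theorem measurable_evalFun {n : ℕ} (f : L.Functions n) (a : Fin n → ℕ) (b : ℕ) :
    Measurable fun M : Str L => M.evalFun f a = b :=
  measurableSet_setOfPred.1 (IsOpen.measurableSet
    (TopologicalSpace.isOpen_generateFrom_of_mem (Or.inl (Or.inl ⟨n, f, a, b, rfl⟩))))

theorem measurable_evalRel {n : ℕ} (r : L.Relations n) (a : Fin n → ℕ) :
    Measurable fun M : Str L => M.evalRel r a :=
  measurableSet_setOfPred.1 (IsOpen.measurableSet
    (TopologicalSpace.isOpen_generateFrom_of_mem (Or.inl (Or.inr ⟨n, r, a, rfl⟩))))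

/-! ### Structures as sets of words -/

/-- The words recording the graphs of the symbols in a structure. -/
def wordSet (M : Str L) : Set (LabelledWord (Option L.Symbols)) :=
  {o | match o.1 with
    -- The unused label `none` keeps the set of labels nonempty even for a language without symbols.
    | none => False
    | some (Sum.inl ⟨_, f⟩) => ∃ a, o.2 = List.ofFn a ++ [M.evalFun f a]
    | some (Sum.inr ⟨_, r⟩) => ∃ a, o.2 = List.ofFn a ∧ M.evalRel r a}

theorem measurable_mem_wordSet (o : LabelledWord (Option L.Symbols)) :
    Measurable fun M : Str L => o ∈ M.wordSet := by
  rcases o with ⟨_ | ⟨⟨n, f⟩ | ⟨n, r⟩⟩, l⟩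
  · exact measurable_const (a := False)
  · have : (fun M : Str L => ((some (Sum.inl ⟨n, f⟩), l) : LabelledWord (Option L.Symbols)) ∈
        M.wordSet) = fun M => ∃ (a : Fin n → ℕ) (b : ℕ), M.evalFun f a = b ∧
          l = List.ofFn a ++ [b] := by
      funext M
      refine propext ⟨fun ⟨a, ha⟩ => ⟨a, _, rfl, ha⟩, ?_⟩
      rintro ⟨a, _, rfl, ha⟩
      exact ⟨a, ha⟩
    rw [this]
    exact Measurable.exists fun a => Measurable.exists fun b =>
      (measurable_evalFun f a b).and measurable_const
  · exact Measurable.exists fun a => measurable_const.and (measurable_evalRel r a)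

theorem mem_wordSet_rel {M : Str L} {n : ℕ} (r : L.Relations n) (a : Fin n → ℕ) :
    ((some (Sum.inr ⟨n, r⟩), List.ofFn a) : LabelledWord (Option L.Symbols)) ∈ M.wordSet ↔
      M.evalRel r a := by
  constructor
  · rintro ⟨a', h, h'⟩
    rwa [List.ofFn_injective h]
  · exact fun h => ⟨a, rfl, h⟩

theorem mem_wordSet_fun {M : Str L} {n : ℕ} (f : L.Functions n) (a : Fin n → ℕ) (b : ℕ) :
    ((some (Sum.inl ⟨n, f⟩), List.ofFn a ++ [b]) : LabelledWord (Option L.Symbols)) ∈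
      M.wordSet ↔ M.evalFun f a = b := by
  constructor
  · rintro ⟨a', h⟩
    obtain ⟨h1, h2⟩ := List.append_inj' h rfl
    rw [List.ofFn_injective h1]
    simpa using h2.symm
  · rintro rfl
    exact ⟨a, rfl⟩

theorem move_mem_wordSet {M N : Str L} {σ : Equiv.Perm ℕ}
    (hfun : ∀ (n : ℕ) (f : L.Functions n) a, σ (M.evalFun f a) = N.evalFun f (σ ∘ a))
    (hrel : ∀ (n : ℕ) (r : L.Relations n) a, M.evalRel r a → N.evalRel r (σ ∘ a))
    {o : LabelledWord (Option L.Symbols)} (ho : o ∈ M.wordSet) : move σ o ∈ N.wordSet := by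
  rcases o with ⟨_ | ⟨⟨n, f⟩ | ⟨n, r⟩⟩, l⟩
  · exact ho
  · obtain ⟨a, rfl⟩ := ho
    exact ⟨σ ∘ a, by simp [move, List.map_ofFn, hfun]⟩
  · obtain ⟨a, rfl, ha⟩ := ho
    exact ⟨σ ∘ a, by simp [move, List.map_ofFn], hrel n r a ha⟩

theorem iso_iff_wordSet {M N : Str L} :
    Str.Iso M N ↔ ∃ σ : Equiv.Perm ℕ, ∀ o, o ∈ M.wordSet ↔ move σ o ∈ N.wordSet := by
  constructor
  · rintro ⟨Φ⟩
    let σ : ℕ ≃ ℕ := @Language.Equiv.toEquiv L ℕ ℕ M.str N.str Φ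
    have hfun : ∀ (n : ℕ) (f : L.Functions n) a, σ (M.evalFun f a) = N.evalFun f (σ ∘ a) :=
      fun n f a => @Language.Equiv.map_fun' L ℕ ℕ M.str N.str Φ _ f a
    have hrel : ∀ (n : ℕ) (r : L.Relations n) a, N.evalRel r (σ ∘ a) ↔ M.evalRel r a :=
      fun n r a => @Language.Equiv.map_rel' L ℕ ℕ M.str N.str Φ _ r a
    have hinv : ∀ {n : ℕ} (a : Fin n → ℕ), a = σ ∘ (σ.symm ∘ a) := fun a => by
      funext i
      simp
    refine ⟨σ, fun o => ⟨move_mem_wordSet hfun fun n r a => (hrel n r a).2, fun ho => ?_⟩⟩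
    have := move_mem_wordSet (σ := σ⁻¹) (M := N) (N := M) (fun n f a => ?_) (fun n r a h => ?_) ho
    · simpa using this
    · change σ.symm _ = M.evalFun f (σ.symm ∘ a)
      rw [Equiv.symm_apply_eq, hfun, ← hinv]
    · change M.evalRel r (σ.symm ∘ a)
      rwa [← hrel, ← hinv]
  · rintro ⟨σ, hσ⟩
    refine ⟨@Language.Equiv.mk L ℕ ℕ M.str N.str σ (fun {n} f a => ?_) fun {n} r a => ?_⟩
    · have := (hσ _).1 ((mem_wordSet_fun f a _).2 rfl)
      rw [move, List.map_append, List.map_ofFn] at this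
      exact ((mem_wordSet_fun f (σ ∘ a) _).1 this).symm
    · have := hσ (some (Sum.inr ⟨n, r⟩), List.ofFn a)
      rw [move, List.map_ofFn, mem_wordSet_rel, mem_wordSet_rel] at this
      exact this.symm

end Str

instance {R : Type*} [Countable R] : Countable (langFour R).Symbols := by
  have h1 : Countable (Σ n, ModFunctions R n) := by
    refine Function.Injective.countable (β := Option (Option R)) (f := fun t => match t with
      | ⟨_, .plus⟩ => none
      | ⟨_, .zero⟩ => some none
      | ⟨_, .scal r⟩ => some (some r)) ?_
    rintro ⟨_, _ | _ | r⟩ ⟨_, _ | _ | s⟩ h <;> simp_all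
  have h2 : Countable (Σ n, SubmodRelations n) := by
    refine Function.Injective.countable (β := Fin 4) (f := fun t => match t with
      | ⟨_, .mem i⟩ => i) ?_
    rintro ⟨_, ⟨i⟩⟩ ⟨_, ⟨j⟩⟩ h
    simp_all
  exact inferInstanceAs (Countable ((Σ n, ModFunctions R n) ⊕ (Σ n, SubmodRelations n)))

end BorelModels

theorem mainTheorem7 (R : Type*) [Ring R] [Nontrivial R] [Countable R] :
    BorelModels.BorelComplete
      (BorelModels.InfFormula.ofFirstOrder '' BorelModels.fourSubmodulesTheory R) := by
  intro L _ T _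
  obtain ⟨p, hp⟩ := SeqModule.exists_coprimeFamily (Fin 4 ⊕ WordEndo R (Option L.Symbols))
  obtain ⟨e⟩ : Nonempty (ℕ ≃ WordModule.CodeModule R (Option L.Symbols)) :=
    nonempty_equiv_of_countable
  refine ⟨fun M => ⟨BorelModels.strOfModule e (WordModule.codeSubmodules p M.1.wordSet),
    BorelModels.strOfModule_mem_mod e _⟩, Measurable.subtype_mk ?_, fun M N => ?_⟩
  · refine BorelModels.Str.measurable_of_eval (fun n f a b => ?_) fun n r a => ?_
    -- The operations are transported along a fixed `e` and do not depend on the model; only the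
    -- four predicates vary.
    · cases f with
      | plus => exact measurable_const (a := e.symm (e (a 0) + e (a 1)) = b)
      | zero => exact measurable_const (a := e.symm 0 = b)
      | scal r => exact measurable_const (a := e.symm (r • e (a 0)) = b)
    · cases r with
      | mem i =>
        exact WordModule.measurable_mem_codeSubmodules p hp
          (fun o => (BorelModels.Str.measurable_mem_wordSet o).comp measurable_subtype_coe) i _
  · rw [BorelModels.strOfModule_iso_iff, BorelModels.Str.iso_iff_wordSet]
    exact ⟨fun ⟨Ψ, hΨ⟩ => WordModule.exists_perm_of_code hp Ψ hΨ,
      fun ⟨σ, hσ⟩ => WordModule.exists_code_of_perm σ hσ⟩
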